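/- **Setting.** Let $n\ge 1$. Agents $1,\dots,n$ arrive one by one in this order, and agent $i$ has a value $v_i\ge 0$ drawn independently from a law with cumulative distribution function $F_i$. Every $F_i$ is regular: it has a density $f_i$ for which the virtual value $v-\frac{1-F_i(v)}{f_i(v)}$ is defined and non-decreasing on $\{v:0<F_i(v)<1\}$. Availability-based externalities are given by a non-decreasing $w$ with values in $[0,1]$, $w_0=0$, and $w_k=1$ for $k\ge n$: if the set $S$ of agents buys, an agent in $S$ derives her full value $v_i$ and pays her price, while an agent outside $S$ derives $w_{|S|}v_i$ and pays nothing. The seller posts a price matrix $\mathbf p=(p_i^j)_{0\le j<i\le n}$ with entries in $[0,\infty]$; agent $i$ is offered the price $p_i^j$ if exactly $j$ agents bought before her. In the subgame perfect equilibrium, agent $i$ buys in this case if and only if $v_i\ge T_i^j$, where $T_i^j\in[0,\infty]$ is the least $v$ with $$v\ \ge\ p_i^j+v\sum_{\ell\ge j} w_\ell\, r_{i+1,j}^{\ell};$$ here $r_{i+1,j}^{\ell}$ is the probability that exactly $\ell$ agents buy overall, given that exactly $j$ of the agents $1,\dots,i$ bought. Let $q_{i,j}$ be the probability that exactly $j$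 agents buy before agent $i$ arrives. With $\infty\cdot 0=0$, the expected revenue is $$\mathcal R(\mathbf p)=\sum_{i}\sum_{j<i} q_{i,j}\,p_i^j\,(1-F_i(T_i^j)).$$ An algorithm is a program for a real random access machine. Exact field operations on reals (with rational constants), addition and truncated subtraction of natural numbers, comparisons and memory accesses cost one step each. Its input consists of $n$ and unit-cost access to the values $w_k$, to $F_i(x)$, and to the inverse $F_i^{-1}(q)$ for $0<q<1$. **Theorem.** 1. There are a program, independent of the instance, and constants $C,d$ such that on every instance as above, with any $n\ge 1$, the program halts after at most $d\,n^d$ steps and outputs a price matrix $\mathbf p$ with $$\sup_{\mathbf p'}\mathcal R(\mathbf p')\ \le\ C\,(1+\log n)\;\mathcal R(\mathbf p),$$ the supremum being over all price matrices; that is, $\mathbf p$ is an $O(\log n)$-approximation. 2. For $1\le k\le n$ let $\mathcal R^*_k$ be the optimal expected revenue of a sequential posted-price sale of $k$ identical private units (no externalities) to the same agents in the same order, with prices that may depend on the number of units sold so far. For every instance and every price matrix $\mathbf p$, the quantities $$\mathcal R^k=\sum_{i}\sum_{j<k}q_{i,j}\,T_i^j\,(1-F_i(T_i^j))\sum_{\ell<k}r_{i+1,j}^{\ell}$$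 satisfy $\mathcal R(\mathbf p)=\sum_{k=1}^n (w_k-w_{k-1})\,\mathcal R^k$ and $\mathcal R^k\le \mathcal R^*_k$ for $1\le k\le n$, and $$\mathcal R(\mathbf p)\ \le\ \sum_{\ell=0}^{\lfloor\log_2 n\rfloor}\bigl(w_{2^{\ell+1}-1}-w_{2^\ell-1}\bigr)\,\mathcal R^*_{\min(2^{\ell+1}-1,\,n)}.$$ -/

import Mathlib

open scoped NNReal ENNReal

noncomputable section

namespace AvailabilitySale

/-! Agents are numbered `0, 1, …, n - 1` and arrive in this order; `law i` is the law of the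
value of agent `i`, and the values are independent.  Sequences indexed by `ℕ` are used for
convenience: only `law i` with `i < n`, and only prices `p i j` with `j ≤ i < n`, ever matter. -/

/-! ### Valuations and externalities -/

/-- A regular distribution of non-negative values: an atomless probability law with a density `f`
for which the virtual value `v - (1 - F v) / f v` is defined and non-decreasing on the range
of values `{v | 0 < F v < 1}`, where `F` is the cumulative distribution function. -/
def IsRegular (μ : MeasureTheory.Measure ℝ) : Prop :=
  MeasureTheory.IsProbabilityMeasure μ ∧ μ (Set.Iio 0) = 0 ∧
  ∃ f : ℝ → ℝ, Measurable f ∧ (∀ v, 0 ≤ f v) ∧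
    μ = (MeasureTheory.volume : MeasureTheory.Measure ℝ).withDensity
      (fun v => ENNReal.ofReal (f v)) ∧
    (∀ v, 0 < ProbabilityTheory.cdf μ v → ProbabilityTheory.cdf μ v < 1 → 0 < f v) ∧
    MonotoneOn (fun v => v - (1 - ProbabilityTheory.cdf μ v) / f v)
      {v | 0 < ProbabilityTheory.cdf μ v ∧ ProbabilityTheory.cdf μ v < 1}

/-- The availability function: an agent who does not buy derives the fraction `w k` of her value
when exactly `k` agents buy.  It is extended by `w k = 1` for `k ≥ n`. -/
def IsAvailability (n : ℕ) (w : ℕ → ℝ≥0) : Prop :=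
  w 0 = 0 ∧ Monotone w ∧ ∀ k, n ≤ k → w k = 1

/-- `1 - F t`: the probability that the value is at least the threshold `t`
(an agent with threshold `∞` never buys). -/
def buyProb (μ : MeasureTheory.Measure ℝ) (t : ℝ≥0∞) : ℝ≥0∞ :=
  μ {v | t ≤ ENNReal.ofReal v}

/-- `F t`: the probability that the value is below the threshold `t`. -/
def passProb (μ : MeasureTheory.Measure ℝ) (t : ℝ≥0∞) : ℝ≥0∞ :=
  μ {v | ENNReal.ofReal v < t}

/-! ### The subgame perfect equilibrium of a price matrix -/

/-- The least value `v` for which buying at price `price` (utility `v - price`) is at least as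
good as not buying and deriving the expected fraction `share` of the value. -/
def threshold (price share : ℝ≥0∞) : ℝ≥0∞ :=
  sInf {v | v * share + price ≤ v}

/-- `finalProb n law w p m i j k`: when agent `i` is about to arrive, `m` agents (`i` included) are
still to come and `j` agents have bought, the probability that exactly `k` agents buy overall,
all remaining agents playing their equilibrium thresholds (backward induction). -/
def finalProb (n : ℕ) (law : ℕ → MeasureTheory.Measure ℝ) (w : ℕ → ℝ≥0)
    (p : ℕ → ℕ → ℝ≥0∞) : ℕ → ℕ → ℕ → ℕ → ℝ≥0∞
  | 0, _, j, k => if k = j then 1 else 0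
  | m + 1, i, j, k =>
    let t := threshold (p i j)
      (∑ l ∈ Finset.range (n + 1), (w l : ℝ≥0∞) * finalProb n law w p m (i + 1) j l)
    passProb (law i) t * finalProb n law w p m (i + 1) j k +
      buyProb (law i) t * finalProb n law w p m (i + 1) (j + 1) k

/-- `r_{i+1,j}^k`: the probability that exactly `k` agents buy overall, given that `j` agents
bought among the agents `0, …, i`. -/
def finalProbAfter (n : ℕ) (law : ℕ → MeasureTheory.Measure ℝ) (w : ℕ → ℝ≥0)
    (p : ℕ → ℕ → ℝ≥0∞) (i j k : ℕ) : ℝ≥0∞ :=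
  finalProb n law w p (n - (i + 1)) (i + 1) j k

/-- `T_i^j`: the equilibrium threshold of agent `i` when `j` agents bought before her. -/
def eqThreshold (n : ℕ) (law : ℕ → MeasureTheory.Measure ℝ) (w : ℕ → ℝ≥0)
    (p : ℕ → ℕ → ℝ≥0∞) (i j : ℕ) : ℝ≥0∞ :=
  threshold (p i j)
    (∑ l ∈ Finset.range (n + 1), (w l : ℝ≥0∞) * finalProbAfter n law w p i j l)

/-- `q_{i,j}`: the probability that exactly `j` agents buy before agent `i` arrives, when the
agents use the threshold matrix `T`. -/
def reachProb (law : ℕ → MeasureTheory.Measure ℝ) (T : ℕ → ℕ → ℝ≥0∞) : ℕ → ℕ → ℝ≥0∞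
  | 0, 0 => 1
  | 0, _ + 1 => 0
  | i + 1, 0 => reachProb law T i 0 * passProb (law i) (T i 0)
  | i + 1, j + 1 => reachProb law T i (j + 1) * passProb (law i) (T i (j + 1)) +
      reachProb law T i j * buyProb (law i) (T i j)

/-- The expected revenue when prices `p` are posted and the agents use the thresholds `T`
(an infinite price contributes `∞ * 0 = 0`). -/
def saleRevenue (n : ℕ) (law : ℕ → MeasureTheory.Measure ℝ) (T p : ℕ → ℕ → ℝ≥0∞) : ℝ≥0∞ :=
  ∑ i ∈ Finset.range n, ∑ j ∈ Finset.range (i + 1),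
    reachProb law T i j * (p i j * buyProb (law i) (T i j))

/-- The expected revenue of the price matrix `p` in the sequential sale: `p i j` is the price
offered to agent `i` when `j` agents bought before her arrival. -/
def revenue (n : ℕ) (law : ℕ → MeasureTheory.Measure ℝ) (w : ℕ → ℝ≥0)
    (p : ℕ → ℕ → ℝ≥0∞) : ℝ≥0∞ :=
  saleRevenue n law (eqThreshold n law w p) p

/-- The optimal revenue of a price matrix. -/
def optRevenue (n : ℕ) (law : ℕ → MeasureTheory.Measure ℝ) (w : ℕ → ℝ≥0) : ℝ≥0∞ :=
  ⨆ p : ℕ → ℕ → ℝ≥0∞, revenue n law w p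

/-! ### Private sales of `k` identical units, and the revenue components -/

/-- The price matrix `p` with all prices raised to `∞` once `k` units are sold. -/
def stopAfter (k : ℕ) (p : ℕ → ℕ → ℝ≥0∞) (i j : ℕ) : ℝ≥0∞ :=
  if j < k then p i j else ⊤

/-- The optimal expected revenue of a sequential posted-price sale of `k` identical private units
(no externalities, so that thresholds are prices), in the same order of arrival; prices may
depend on the number of units sold before. -/
def optPrivate (n : ℕ) (law : ℕ → MeasureTheory.Measure ℝ) (k : ℕ) : ℝ≥0∞ :=
  ⨆ p : ℕ → ℕ → ℝ≥0∞, saleRevenue n law (stopAfter k p) (stopAfter k p)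

/-- The component
`R^k = ∑_i ∑_{j < k} q_{i,j} T_i^j (1 - F_i(T_i^j)) r_{i+1,j}^{<k}` at the equilibrium of `p`. -/
def component (n : ℕ) (law : ℕ → MeasureTheory.Measure ℝ) (w : ℕ → ℝ≥0)
    (p : ℕ → ℕ → ℝ≥0∞) (k : ℕ) : ℝ≥0∞ :=
  ∑ i ∈ Finset.range n, ∑ j ∈ Finset.range k,
    reachProb law (eqThreshold n law w p) i j *
      (eqThreshold n law w p i j * buyProb (law i) (eqThreshold n law w p i j)) *
      ∑ l ∈ Finset.range k, finalProbAfter n law w p i j l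

/-! ### Algorithms: programs for a real random access machine

The machine has arrays of natural numbers and arrays of real numbers.  Every operation (addition
and truncated subtraction of natural numbers; exact field operations on real numbers, with
rational constants), every comparison, every memory access and every query costs one step.
The distributions are accessed by value queries to the cumulative distribution functions and to
their inverses. -/

/-- The input that a program may query. -/
structure Oracle where
  weight : ℕ → ℝ
  cdf : ℕ → ℝ → ℝ
  quantile : ℕ → ℝ → ℝ

/-- The generalized inverse `min {x | q ≤ F x}` for `0 < q < 1` (and `0` for all other `q`). -/
def quantile (μ : MeasureTheory.Measure ℝ) (q : ℝ) : ℝ :=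
  open Classical in
  if 0 < q ∧ q < 1 then sInf {x | q ≤ ProbabilityTheory.cdf μ x} else 0

def oracle (law : ℕ → MeasureTheory.Measure ℝ) (w : ℕ → ℝ≥0) : Oracle where
  weight k := w k
  cdf i x := ProbabilityTheory.cdf (law i) x
  quantile i q := quantile (law i) q

/-- Memory: cell `(a, i, j)` is entry `(i, j)` of array `a`; `out` is the output price matrix. -/
structure State where
  nat : ℕ → ℕ → ℕ → ℕ
  real : ℕ → ℕ → ℕ → ℝ
  out : ℕ → ℕ → ℝ≥0∞

/-- The initial memory: cell `(0, 0, 0)` of the natural-number memory holds `n`, everything else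
is `0`. -/
def State.init (n : ℕ) : State where
  nat a i j := if a = 0 ∧ i = 0 ∧ j = 0 then n else 0
  real _ _ _ := 0
  out _ _ := 0

/-- Expressions for natural numbers; `get a e e'` reads entry `(e, e')` of array `a`. -/
inductive NatExpr where
  | const (c : ℕ)
  | get (a : ℕ) (e e' : NatExpr)
  | add (e e' : NatExpr)
  | sub (e e' : NatExpr)

def NatExpr.eval (s : State) : NatExpr → ℕ
  | const c => c
  | get a e e' => s.nat a (e.eval s) (e'.eval s)
  | add e e' => e.eval s + e'.eval s
  | sub e e' => e.eval s - e'.eval s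

def NatExpr.cost : NatExpr → ℕ
  | const _ => 1
  | get _ e e' => e.cost + e'.cost + 1
  | add e e' => e.cost + e'.cost + 1
  | sub e e' => e.cost + e'.cost + 1

/-- Expressions for real numbers, including queries to the input. -/
inductive RealExpr where
  | const (c : ℚ)
  | ofNat (e : NatExpr)
  | get (a : ℕ) (e e' : NatExpr)
  | add (x y : RealExpr)
  | sub (x y : RealExpr)
  | mul (x y : RealExpr)
  | div (x y : RealExpr)
  | weight (k : NatExpr)
  | cdf (i : NatExpr) (x : RealExpr)
  | quantile (i : NatExpr) (q : RealExpr)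

def RealExpr.eval (O : Oracle) (s : State) : RealExpr → ℝ
  | const c => c
  | ofNat e => e.eval s
  | get a e e' => s.real a (e.eval s) (e'.eval s)
  | add x y => x.eval O s + y.eval O s
  | sub x y => x.eval O s - y.eval O s
  | mul x y => x.eval O s * y.eval O s
  | div x y => x.eval O s / y.eval O s
  | weight k => O.weight (k.eval s)
  | cdf i x => O.cdf (i.eval s) (x.eval O s)
  | quantile i q => O.quantile (i.eval s) (q.eval O s)

def RealExpr.cost : RealExpr → ℕ
  | const _ => 1
  | ofNat e => e.cost + 1
  | get _ e e' => e.cost + e'.cost + 1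
  | add x y => x.cost + y.cost + 1
  | sub x y => x.cost + y.cost + 1
  | mul x y => x.cost + y.cost + 1
  | div x y => x.cost + y.cost + 1
  | weight k => k.cost + 1
  | cdf i x => i.cost + x.cost + 1
  | quantile i q => i.cost + q.cost + 1

/-- Tests: comparison of two natural numbers or of two real numbers. -/
inductive Test where
  | natLe (e e' : NatExpr)
  | realLe (x y : RealExpr)

def Test.Holds (O : Oracle) (s : State) : Test → Prop
  | natLe e e' => e.eval s ≤ e'.eval s
  | realLe x y => x.eval O s ≤ y.eval O s

def Test.cost : Test → ℕ
  | natLe e e' => e.cost + e'.cost + 1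
  | realLe x y => x.cost + y.cost + 1

/-- Programs.  `emit i j x` sets the output price of agent `i` in state `j` to the value of `x`,
and `emitTop i j` sets it to `∞`. -/
inductive Program where
  | skip
  | setNat (a : ℕ) (i j e : NatExpr)
  | setReal (a : ℕ) (i j : NatExpr) (x : RealExpr)
  | emit (i j : NatExpr) (x : RealExpr)
  | emitTop (i j : NatExpr)
  | seq (A B : Program)
  | ite (b : Test) (A B : Program)
  | while (b : Test) (A : Program)

/-- `f` with its value at `(a, i, j)` replaced by `x`. -/
def update₃ {α : Type} (f : ℕ → ℕ → ℕ → α) (a i j : ℕ) (x : α) : ℕ → ℕ → ℕ → α :=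
  fun a' i' j' => if a' = a ∧ i' = i ∧ j' = j then x else f a' i' j'

/-- `f` with its value at `(i, j)` replaced by `x`. -/
def update₂ {α : Type} (f : ℕ → ℕ → α) (i j : ℕ) (x : α) : ℕ → ℕ → α :=
  fun i' j' => if i' = i ∧ j' = j then x else f i' j'

/-- `Exec O A s s' t`: program `A`, started in state `s` with input `O`, halts in state `s'`
after exactly `t` steps. -/
inductive Exec (O : Oracle) : Program → State → State → ℕ → Prop where
  | skip (s : State) : Exec O .skip s s 1
  | setNat (s : State) (a : ℕ) (i j e : NatExpr) :
      Exec O (.setNat a i j e) s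
        { s with nat := update₃ s.nat a (i.eval s) (j.eval s) (e.eval s) }
        (i.cost + j.cost + e.cost + 1)
  | setReal (s : State) (a : ℕ) (i j : NatExpr) (x : RealExpr) :
      Exec O (.setReal a i j x) s
        { s with real := update₃ s.real a (i.eval s) (j.eval s) (x.eval O s) }
        (i.cost + j.cost + x.cost + 1)
  | emit (s : State) (i j : NatExpr) (x : RealExpr) :
      Exec O (.emit i j x) s
        { s with out := update₂ s.out (i.eval s) (j.eval s) (ENNReal.ofReal (x.eval O s)) }
        (i.cost + j.cost + x.cost + 1)
  | emitTop (s : State) (i j : NatExpr) :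
      Exec O (.emitTop i j) s
        { s with out := update₂ s.out (i.eval s) (j.eval s) ⊤ }
        (i.cost + j.cost + 1)
  | seq {A B : Program} {s s' s'' : State} {t t' : ℕ} :
      Exec O A s s' t → Exec O B s' s'' t' → Exec O (.seq A B) s s'' (t + t')
  | iteTrue {b : Test} {A B : Program} {s s' : State} {t : ℕ} :
      b.Holds O s → Exec O A s s' t → Exec O (.ite b A B) s s' (b.cost + t)
  | iteFalse {b : Test} {A B : Program} {s s' : State} {t : ℕ} :
      ¬ b.Holds O s → Exec O B s s' t → Exec O (.ite b A B) s s' (b.cost + t)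
  | whileFalse {b : Test} {A : Program} {s : State} :
      ¬ b.Holds O s → Exec O (.while b A) s s b.cost
  | whileTrue {b : Test} {A : Program} {s s' s'' : State} {t t' : ℕ} :
      b.Holds O s → Exec O A s s' t → Exec O (.while b A) s' s'' t' →
      Exec O (.while b A) s s'' (b.cost + t + t')

end AvailabilitySale

end

open scoped NNReal ENNReal

noncomputable section

namespace AvailabilitySale

/-! Upper bound. A buyer's expected payment is her expected gain from buying, `T (1 - F T) (1 -
share)`. Abel summation of `w` writes `1 - share` as a combination, with weights `w k - w (k - 1)`,
of the probabilities that fewer than `k` agents buy; this is `revenue_eq_sum_component`. Posting the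
thresholds themselves as private prices and stopping after `k` sales gives
`component_le_optPrivate`. Grouping the `k` in dyadic blocks leaves about `log n` terms, each an
increment of `w` times a private optimum.

Benchmark. Regularity makes the revenue of each agent concave in her selling probability
(`IsRegular.exists_supergradient`). Probabilities are restricted to multiples of `1 / (4 n)`. For
each `u ≤ n` a greedy allocation spends at most `2 n u` grid steps, that is, total probability at
most `u / 2`. By concavity the last marginal gain is a Lagrange multiplier, and weak duality
(`optPrivate_le_of_multiplier`) shows that the private optimum for up to `3 u` units is at most `9
V`, where `V` is the ex-ante revenue of the allocation (`GreedyAlloc.optPrivate_le`).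

Lower bound. Any threshold is induced by the price `T (1 - share)` when `share < 1`, and the shares
follow by backward induction. Using the allocation as long as fewer than `u` agents have bought,
each agent still meets such a state with probability at least `1 / 2` by Markov, and `1 - share` is
at least half of `discount w u`. Hence the revenue is at least `discount w u * V / 4`
(`le_revenue_of_eq_allocPrice`). The discount is `1 - w u` for `u ≥ 2`, but `1` for `u = 1`: there
the later agents buy with total probability at most `1 / 2`, so the share is small even when `w 1 =
1`.

Conclusion. The program maximizes the score `discount w u * V` over `u`. Every dyadic block is at
most nine times the best score, which gives the factor `36 (log₂ n + 1)`. The running time follows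
from a small Hoare-style calculus with step bounds. -/

/-! ### Regular laws and concavity of the revenue curve -/

open MeasureTheory ProbabilityTheory in
lemma cdf_sub_cdf_eq_integral {μ : Measure ℝ} [IsProbabilityMeasure μ] {f : ℝ → ℝ}
    (hm : Measurable f) (h0 : ∀ v, 0 ≤ f v)
    (hμ : μ = (volume : Measure ℝ).withDensity (fun v => ENNReal.ofReal (f v))) :
    Integrable f ∧ ∀ a b, cdf μ b - cdf μ a = ∫ x in a..b, f x := by
  have hint : Integrable f := by
    refine ⟨hm.aestronglyMeasurable, ?_⟩
    rw [hasFiniteIntegral_iff_ofReal (Filter.Eventually.of_forall h0)]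
    have : μ Set.univ = 1 := measure_univ
    rw [hμ, withDensity_apply _ MeasurableSet.univ, Measure.restrict_univ] at this
    simp [this]
  have key : ∀ x, cdf μ x = ∫ y in Set.Iic x, f y := fun x => by
    rw [cdf_eq_real, measureReal_def]
    conv_lhs => rw [hμ]
    rw [withDensity_apply _ measurableSet_Iic,
      integral_eq_lintegral_of_nonneg_ae (Filter.Eventually.of_forall h0) hm.aestronglyMeasurable]
  refine ⟨hint, fun a b => ?_⟩
  rw [key, key, intervalIntegral.integral_Iic_sub_Iic hint.integrableOn hint.integrableOn]

open MeasureTheory ProbabilityTheory in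
lemma IsRegular.continuous_cdf {μ : Measure ℝ} (h : IsRegular μ) : Continuous (cdf μ) := by
  obtain ⟨hp, -, f, hm, h0, hμ, -, -⟩ := h
  obtain ⟨hint, hF⟩ := cdf_sub_cdf_eq_integral hm h0 hμ
  have : (fun x => cdf μ x) = fun x => cdf μ 0 + ∫ y in (0 : ℝ)..x, f y := by
    funext x; rw [← hF]; ring
  rw [show ⇑(cdf μ) = fun x => cdf μ x from rfl, this]
  exact continuous_const.add
    (intervalIntegral.continuous_primitive (fun a b => hint.intervalIntegrable) 0)

open MeasureTheory ProbabilityTheory in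
/-- The derivative of `x ↦ (x - φ) (1 - F x)` is `1 - F x - (x - φ) f x` almost everywhere. -/
lemma shifted_revenue_sub {μ : Measure ℝ} {f : ℝ → ℝ} (hint : Integrable f)
    (hF : ∀ a b, cdf μ b - cdf μ a = ∫ x in a..b, f x) (φ a b : ℝ) :
    ∃ g : ℝ → ℝ, (∀ᵐ x, g x = (1 - cdf μ x) - (x - φ) * f x) ∧
      (b - φ) * (1 - cdf μ b) - (a - φ) * (1 - cdf μ a) = ∫ x in a..b, g x := by
  have hrep : (fun x => 1 - cdf μ x) = fun x => (1 - cdf μ a) - ∫ y in a..x, f y := by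
    funext x; rw [← hF]; ring
  have hid : AbsolutelyContinuousOnInterval (fun x : ℝ => x - φ) a b :=
    (contDiff_id.sub contDiff_const).contDiffOn.absolutelyContinuousOnInterval
  have hS : AbsolutelyContinuousOnInterval (fun x => 1 - cdf μ x) a b := by
    rw [hrep]
    have hc : AbsolutelyContinuousOnInterval (fun _ : ℝ => 1 - cdf μ a) a b :=
      contDiff_const.contDiffOn.absolutelyContinuousOnInterval
    exact hc.fun_sub
      (hint.intervalIntegrable.absolutelyContinuousOnInterval_intervalIntegral Set.left_mem_uIcc)
  refine ⟨fun x => deriv (fun x => (x - φ) * (1 - cdf μ x)) x, ?_,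
    ((hid.fun_mul hS).integral_deriv_eq_sub).symm⟩
  filter_upwards [LocallyIntegrable.ae_hasDerivAt_integral hint.locallyIntegrable] with x hx
  have h1 : HasDerivAt (fun x => 1 - cdf μ x) (-f x) x := by
    rw [hrep]; exact (hx a).const_sub _
  have h2 : HasDerivAt (fun x : ℝ => x - φ) 1 x := (hasDerivAt_id x).sub_const φ
  rw [(h2.fun_mul h1).deriv]; ring

open MeasureTheory ProbabilityTheory in
/-- The revenue of a regular law is a concave function of the selling probability: it has a
supergradient at every interior price. -/
theorem IsRegular.exists_supergradient {μ : Measure ℝ} (h : IsRegular μ) {b : ℝ}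
    (hb : 0 < cdf μ b) (hb1 : cdf μ b < 1) :
    ∃ φ : ℝ, ∀ v, v * (1 - cdf μ v) ≤
      b * (1 - cdf μ b) + φ * ((1 - cdf μ v) - (1 - cdf μ b)) := by
  have hcont := h.continuous_cdf
  obtain ⟨hp, -, f, hm, h0, hμ, hpos, hmono⟩ := h
  obtain ⟨hint, hF⟩ := cdf_sub_cdf_eq_integral hm h0 hμ
  have hmc := monotone_cdf μ
  -- The slope is the virtual value at `b`. Where `0 < F < 1`, the derivative of `(x - φ) (1 - F x)`
  -- is `f x` times `φ` minus the virtual value at `x`, so this function increases up to `b` and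
  -- decreases afterwards.
  set φ := b - (1 - cdf μ b) / f b with hφ
  suffices H : ∀ v, (v - φ) * (1 - cdf μ v) ≤ (b - φ) * (1 - cdf μ b) from
    ⟨φ, fun v => by linarith [H v]⟩
  have main : ∀ v, 0 < cdf μ v → (v - φ) * (1 - cdf μ v) ≤ (b - φ) * (1 - cdf μ b) := by
    intro v hv
    rcases (cdf_le_one μ v).lt_or_eq with hv1 | hv1
    · rcases le_total v b with hvb | hvb
      · obtain ⟨g, hg, hint⟩ := shifted_revenue_sub hint hF φ v b
        have : 0 ≤ ∫ x in v..b, g x := by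
          refine intervalIntegral.integral_nonneg_of_ae_restrict hvb ?_
          filter_upwards [ae_restrict_of_ae hg, ae_restrict_mem measurableSet_Icc] with x hx hxm
          have hx0 : 0 < cdf μ x := hv.trans_le (hmc hxm.1)
          have hx1 : cdf μ x < 1 := (hmc hxm.2).trans_lt hb1
          have := hmono ⟨hx0, hx1⟩ ⟨hb, hb1⟩ hxm.2
          have hfx := hpos x hx0 hx1
          simp only [← hφ] at this
          rw [hx]
          have h2 : x - φ ≤ (1 - cdf μ x) / f x := by linarith
          rw [le_div_iff₀ hfx] at h2
          simpa using h2
        linarith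
      · obtain ⟨g, hg, hint⟩ := shifted_revenue_sub hint hF φ b v
        have : 0 ≤ ∫ x in b..v, -g x := by
          refine intervalIntegral.integral_nonneg_of_ae_restrict hvb ?_
          filter_upwards [ae_restrict_of_ae hg, ae_restrict_mem measurableSet_Icc] with x hx hxm
          have hx0 : 0 < cdf μ x := hb.trans_le (hmc hxm.1)
          have hx1 : cdf μ x < 1 := (hmc hxm.2).trans_lt hv1
          have := hmono ⟨hb, hb1⟩ ⟨hx0, hx1⟩ hxm.1
          have hfx := hpos x hx0 hx1
          simp only [← hφ] at this
          rw [hx]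
          have h2 : (1 - cdf μ x) / f x ≤ x - φ := by linarith
          rw [div_le_iff₀ hfx] at h2
          simpa using h2
        rw [intervalIntegral.integral_neg] at this
        linarith
    -- At `F v = 1` the left side is `0` and the right side is `(1 - F b) ^ 2 / f b`.
    · rw [hv1, sub_self, mul_zero, hφ, sub_sub_cancel]
      exact mul_nonneg (div_nonneg (by linarith) (h0 b)) (by linarith)
  intro v
  rcases (cdf_nonneg μ v).lt_or_eq with hv | hv
  · exact main v hv
  have hvb : v ≤ b := by
    by_contra! hlt
    linarith [hmc hlt.le]
  -- Monotonicity of the virtual value is unavailable where `F = 0`. The bound is taken at a point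
  -- to the right of `v` with `F = ε`, and then `ε → 0`.
  have hlim : ∀ ε, 0 < ε → ε ≤ cdf μ b →
      (v - φ) * (1 - ε) ≤ (b - φ) * (1 - cdf μ b) := fun ε hε hεb => by
    obtain ⟨x, hx, hxe⟩ := intermediate_value_Icc hvb hcont.continuousOn
      (show ε ∈ Set.Icc (cdf μ v) (cdf μ b) from ⟨by rw [← hv]; exact hε.le, hεb⟩)
    have := main x (by rw [hxe]; exact hε)
    rw [hxe] at this
    refine le_trans (mul_le_mul_of_nonneg_right (by linarith [hx.1]) (by linarith)) this
  have ht : Filter.Tendsto (fun ε : ℝ => (v - φ) * (1 - ε)) (nhdsWithin 0 (Set.Ioi 0))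
      (nhds ((v - φ) * (1 - 0))) :=
    (Continuous.tendsto (by fun_prop) 0).mono_left nhdsWithin_le_nhds
  rw [← hv]
  refine le_of_tendsto ht ?_
  filter_upwards [Ioc_mem_nhdsGT hb] with ε hε
  exact hlim ε hε.1 hε.2

/-! ### Purchase probabilities and the revenue curve on a grid of selling probabilities -/

open MeasureTheory ProbabilityTheory in
lemma IsRegular.cdf_eq_zero {μ : Measure ℝ} (h : IsRegular μ) {x : ℝ} (hx : x ≤ 0) :
    cdf μ x = 0 := by
  have hcont := h.continuous_cdf
  obtain ⟨hp, hneg, -⟩ := h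
  have hlt : ∀ y < 0, cdf μ y = 0 := fun y hy => by
    rw [cdf_eq_real, measureReal_def, measure_mono_null _ hneg]
    · rfl
    · exact fun z hz => lt_of_le_of_lt hz hy
  refine le_antisymm ((monotone_cdf μ hx).trans ?_) (cdf_nonneg μ x)
  refine le_of_tendsto ((hcont.tendsto 0).mono_left (nhdsWithin_le_nhds (s := Set.Iio 0))) ?_
  filter_upwards [self_mem_nhdsWithin] with y hy
  exact (hlt y hy).le

open MeasureTheory ProbabilityTheory in
lemma IsRegular.cdf_quantile {μ : Measure ℝ} (h : IsRegular μ) {q : ℝ} (h0 : 0 < q) (h1 : q < 1) :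
    cdf μ (quantile μ q) = q := by
  have hcont := h.continuous_cdf
  have hz := fun {x} => h.cdf_eq_zero (x := x)
  rw [quantile, if_pos ⟨h0, h1⟩]
  obtain ⟨b, hb⟩ := ((tendsto_cdf_atTop μ).eventually (eventually_gt_nhds h1)).exists
  have hb0 : 0 ≤ b := by
    by_contra! hlt
    rw [hz hlt.le] at hb; linarith
  obtain ⟨x, hx, hxq⟩ := intermediate_value_Icc hb0 hcont.continuousOn
    (show q ∈ Set.Icc (cdf μ 0) (cdf μ b) from ⟨by rw [hz le_rfl]; exact h0.le, hb.le⟩)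
  have hbdd : BddBelow {x | q ≤ cdf μ x} := ⟨0, fun y hy => by
    by_contra! hlt
    rw [Set.mem_ofPred_eq, hz hlt.le] at hy; linarith⟩
  refine le_antisymm ?_ ?_
  · exact (monotone_cdf μ (csInf_le hbdd hxq.ge)).trans hxq.le
  · exact (isClosed_le continuous_const hcont).csInf_mem ⟨x, hxq.ge⟩ hbdd

lemma IsRegular.quantile_pos {μ : MeasureTheory.Measure ℝ} (h : IsRegular μ) {q : ℝ}
    (h0 : 0 < q) (h1 : q < 1) : 0 < quantile μ q := by
  by_contra! hle
  have := h.cdf_quantile h0 h1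
  rw [h.cdf_eq_zero hle] at this
  exact h0.ne this

lemma buyProb_top (μ : MeasureTheory.Measure ℝ) : buyProb μ ⊤ = 0 := by
  simp [buyProb]

open MeasureTheory in
lemma passProb_add_buyProb (μ : Measure ℝ) [IsProbabilityMeasure μ] (t : ℝ≥0∞) :
    passProb μ t + buyProb μ t = 1 := by
  have hm : MeasurableSet {v : ℝ | ENNReal.ofReal v < t} :=
    measurableSet_lt ENNReal.measurable_ofReal measurable_const
  have : {v : ℝ | t ≤ ENNReal.ofReal v} = {v | ENNReal.ofReal v < t}ᶜ := by
    ext v; simp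
  rw [passProb, buyProb, this, measure_add_measure_compl hm, measure_univ]

open MeasureTheory ProbabilityTheory in
lemma IsRegular.buyProb_ofReal {μ : Measure ℝ} (h : IsRegular μ) {t : ℝ} (ht : 0 ≤ t) :
    buyProb μ (ENNReal.ofReal t) = ENNReal.ofReal (1 - cdf μ t) := by
  have hp := h.1
  have hpass : passProb μ (ENNReal.ofReal t) = ENNReal.ofReal (cdf μ t) := by
    have hac : NullSingletonClass μ := by
      obtain ⟨-, -, f, -, -, hμ, -⟩ := h
      rw [hμ]; infer_instance
    rcases ht.eq_or_lt with rfl | ht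
    · simp [passProb, h.cdf_eq_zero le_rfl]
    · rw [ofReal_cdf, ← Iio_ae_eq_Iic.measure_eq]
      refine congrArg μ (Set.ext fun v => ?_)
      simp [ENNReal.ofReal_lt_ofReal_iff ht]
  have := passProb_add_buyProb μ (ENNReal.ofReal t)
  rw [hpass] at this
  rw [ENNReal.ofReal_sub _ (cdf_nonneg μ t), ENNReal.ofReal_one, ← this,
    ENNReal.add_sub_cancel_left ENNReal.ofReal_ne_top]

/-- The revenue from selling to a law with probability `c / N` at a fixed price. -/
def gridRevenue (μ : MeasureTheory.Measure ℝ) (N c : ℕ) : ℝ :=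
  c / N * quantile μ (1 - c / N)

@[simp] lemma gridRevenue_zero (μ : MeasureTheory.Measure ℝ) (N : ℕ) : gridRevenue μ N 0 = 0 := by
  simp [gridRevenue]

/-- The default value `0` of `quantile` makes selling with certainty earn nothing. This can only
lower the right end of the curve, so concavity survives, and greedy never reaches that end. -/
lemma gridRevenue_of_le (μ : MeasureTheory.Measure ℝ) {N c : ℕ} (hN : 0 < N) (h : N ≤ c) :
    gridRevenue μ N c = 0 := by
  have : (1 : ℝ) ≤ c / N := by
    rw [le_div_iff₀ (by positivity)]; simpa using h
  rw [gridRevenue, quantile, if_neg (fun h => by linarith [h.1]), mul_zero]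

lemma grid_mem_Ioo {N c : ℕ} (h0 : 0 < c) (hc : c < N) :
    (0 : ℝ) < 1 - c / N ∧ (1 - c / N : ℝ) < 1 := by
  have hN : (0 : ℝ) < N := by exact_mod_cast h0.trans hc
  have h1 : (c / N : ℝ) < 1 := by rw [div_lt_one hN]; exact_mod_cast hc
  have h2 : (0 : ℝ) < c / N := by positivity
  constructor <;> linarith

lemma IsRegular.gridRevenue_pos {μ : MeasureTheory.Measure ℝ} (h : IsRegular μ) {N c : ℕ}
    (h0 : 0 < c) (hc : c < N) : 0 < gridRevenue μ N c := by
  obtain ⟨h1, h2⟩ := grid_mem_Ioo h0 hc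
  have := h.quantile_pos h1 h2
  have : (0 : ℝ) < N := by exact_mod_cast h0.trans hc
  unfold gridRevenue
  positivity

lemma IsRegular.gridRevenue_nonneg {μ : MeasureTheory.Measure ℝ} (h : IsRegular μ) {N : ℕ}
    (hN : 0 < N) (c : ℕ) : 0 ≤ gridRevenue μ N c := by
  rcases Nat.eq_zero_or_pos c with rfl | h0
  · simp
  rcases lt_or_ge c N with hc | hc
  · exact (h.gridRevenue_pos h0 hc).le
  · exact (gridRevenue_of_le μ hN hc).ge

-- One slope serves the true revenue curve and its grid samples, which lets greedy marginals on the
-- grid bound the revenue at every price.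
open ProbabilityTheory in
lemma IsRegular.exists_grid_supergradient {μ : MeasureTheory.Measure ℝ} (h : IsRegular μ)
    {N c : ℕ} (h0 : 0 < c) (hc : c < N) :
    ∃ φ : ℝ, (∀ v, v * (1 - cdf μ v) ≤ gridRevenue μ N c + φ * (1 - cdf μ v - c / N)) ∧
      ∀ c' ≤ N, gridRevenue μ N c' ≤ gridRevenue μ N c + φ * (c' / N - c / N) := by
  have hN : (0 : ℝ) < N := by exact_mod_cast h0.trans hc
  have eval : ∀ {c' : ℕ}, 0 < c' → c' < N →
      1 - cdf μ (quantile μ (1 - c' / N)) = c' / N := fun h0 hc => by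
    obtain ⟨h1, h2⟩ := grid_mem_Ioo h0 hc
    rw [h.cdf_quantile h1 h2]; ring
  obtain ⟨h1, h2⟩ := grid_mem_Ioo h0 hc
  obtain ⟨φ, hφ⟩ := h.exists_supergradient (b := quantile μ (1 - c / N))
    (by rw [h.cdf_quantile h1 h2]; exact h1) (by rw [h.cdf_quantile h1 h2]; exact h2)
  rw [eval h0 hc, mul_comm (quantile μ _)] at hφ
  replace hφ : ∀ v, v * (1 - cdf μ v) ≤ gridRevenue μ N c + φ * (1 - cdf μ v - c / N) := hφ
  refine ⟨φ, hφ, fun c' hc' => ?_⟩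
  rcases Nat.eq_zero_or_pos c' with rfl | h0'
  -- Selling probability `0` is reached only in the limit `v → ∞`, where non-negativity of the
  -- revenue gives the bound.
  · have ht : Filter.Tendsto (fun v => gridRevenue μ N c + φ * (1 - cdf μ v - c / N)) Filter.atTop
        (nhds (gridRevenue μ N c + φ * (1 - 1 - c / N))) :=
      ((((tendsto_cdf_atTop μ).const_sub 1).sub_const _).const_mul φ).const_add _
    have := ge_of_tendsto ht (b := 0) (by
      filter_upwards [Filter.eventually_ge_atTop 0] with v hv
      exact (mul_nonneg hv (by linarith [cdf_le_one μ v])).trans (hφ v))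
    simpa using this
  · rcases hc'.lt_or_eq with hlt | rfl
    · have := hφ (quantile μ (1 - c' / N))
      rw [eval h0' hlt] at this
      rw [gridRevenue, mul_comm]
      exact this
    -- Selling probability `1` corresponds to the price `0`, with revenue `0`.
    · have := hφ 0
      rw [h.cdf_eq_zero le_rfl] at this
      rw [gridRevenue_of_le μ h0' le_rfl, div_self hN.ne']
      simpa only [zero_mul, sub_zero] using this

/-- Add the supergradient inequalities at the middle point for its two neighbours; the slopes
cancel. -/
lemma IsRegular.gridRevenue_concave {μ : MeasureTheory.Measure ℝ} (h : IsRegular μ) {N c : ℕ}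
    (hc : c + 2 ≤ N) :
    gridRevenue μ N (c + 2) - gridRevenue μ N (c + 1) ≤
      gridRevenue μ N (c + 1) - gridRevenue μ N c := by
  obtain ⟨φ, -, hφ⟩ := h.exists_grid_supergradient (N := N) (Nat.succ_pos c) (by omega)
  have h1 := hφ c (by omega)
  have h2 := hφ (c + 2) hc
  push_cast at h1 h2
  have e : φ * ((c + 2) / N - (c + 1) / N) + φ * (c / N - (c + 1) / N) = 0 := by ring
  linarith

open ProbabilityTheory in
/-- A multiplier `lam` for the next grid step bounds the whole revenue curve. -/
lemma IsRegular.revenue_le_of_marginal_le {μ : MeasureTheory.Measure ℝ} (h : IsRegular μ)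
    {M c : ℕ} {lam : ℝ} (hM : 0 < M) (hlam : 0 ≤ lam)
    (hnext : gridRevenue μ (2 * M) (c + 1) - gridRevenue μ (2 * M) c ≤ lam)
    (hprev : ∀ k < c, gridRevenue μ (2 * M) k ≤ gridRevenue μ (2 * M) (k + 1)) (v : ℝ) :
    v * (1 - cdf μ v) ≤ 2 * (gridRevenue μ (2 * M) c + lam) + 2 * M * lam * (1 - cdf μ v) := by
  have hM' : (0 : ℝ) < M := by exact_mod_cast hM
  have hS0 : 0 ≤ 1 - cdf μ v := by linarith [cdf_le_one μ v]
  have hS1 : 1 - cdf μ v ≤ 1 := by linarith [cdf_nonneg μ v]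
  have hnn := h.gridRevenue_nonneg (N := 2 * M) (by omega)
  have hterm : 0 ≤ 2 * M * lam * (1 - cdf μ v) := by positivity
  -- If `c < M`, take the supergradient at `c + 1`, where the selling probability `q` is at most `1
  -- / 2`. The neighbour `c` gives `φ ≤ 2 M lam`. If `φ < 0`, the right end gives `-φ (1 - q) ≤ g'`,
  -- and `q ≤ 1 / 2` turns this into the loss of a factor `2`.
  rcases lt_or_ge c M with hcM | hcM
  · obtain ⟨φ, hφ, hφ'⟩ := h.exists_grid_supergradient (N := 2 * M) (Nat.succ_pos c) (by omega)
    have hc := hφ' c (by omega)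
    have hN := hφ' (2 * M) le_rfl
    rw [gridRevenue_of_le μ (by omega) le_rfl] at hN
    have hv := hφ v
    have hnnc := hnn (c + 1)
    push_cast at hc hN hv
    set g' := gridRevenue μ (2 * M) (c + 1)
    set g := gridRevenue μ (2 * M) c
    have hq : ((c : ℝ) + 1) / (2 * M) ≤ 1 / 2 := by
      rw [div_le_div_iff₀ (by positivity) (by positivity)]
      have : (c : ℝ) + 1 ≤ M := by exact_mod_cast hcM
      linarith
    have hq0 : 0 ≤ ((c : ℝ) + 1) / (2 * M) := by positivity
    have hdiff : (c : ℝ) / (2 * M) = (c + 1) / (2 * M) - 1 / (2 * M) := by ring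
    rw [hdiff] at hc
    rw [div_self (by positivity)] at hN
    set q := ((c : ℝ) + 1) / (2 * M)
    have hφlam : φ ≤ 2 * M * lam := by
      have : φ * (1 / (2 * M)) ≤ lam := by linarith
      rw [mul_one_div, div_le_iff₀ (by positivity)] at this
      linarith
    rcases le_total q (1 - cdf μ v) with hqS | hqS
    · have h1 := mul_le_mul_of_nonneg_right hφlam (sub_nonneg.2 hqS)
      have h2 : 0 ≤ 2 * M * lam * q := by positivity
      have := hnn c
      linarith
    · rcases le_total 0 φ with hφ0 | hφ0
      · have := mul_nonneg hφ0 (sub_nonneg.2 hqS)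
        linarith
      · have h1 : -φ * (1 / 2) ≤ -φ * (1 - q) :=
          mul_le_mul_of_nonneg_left (by linarith) (by linarith)
        have h2 : -φ * (q - (1 - cdf μ v)) ≤ -φ * (1 / 2) :=
          mul_le_mul_of_nonneg_left (by linarith) (by linarith)
        linarith
  -- Otherwise use selling probability `1 / 2`. Both ends of the curve give `|φ| / 2 ≤ gridRevenue μ
  -- (2 * M) M`, so twice this value bounds all revenues, and `hprev` carries it on to `c`.
  · obtain ⟨φ, hφ, hφ'⟩ := h.exists_grid_supergradient (N := 2 * M) hM (by omega)
    have hz := hφ' 0 (by omega)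
    have hN := hφ' (2 * M) le_rfl
    rw [gridRevenue_of_le μ (by omega) le_rfl] at hN
    have hv := hφ v
    push_cast at hz hN hv
    have hhalf : (M : ℝ) / (2 * M) = 1 / 2 := by field_simp
    rw [hhalf] at hz hN hv
    rw [gridRevenue_zero, zero_div] at hz
    rw [div_self (by positivity)] at hN
    have hmono : ∀ k, M ≤ k → k ≤ c → gridRevenue μ (2 * M) M ≤ gridRevenue μ (2 * M) k := by
      intro k hk
      induction k, hk using Nat.le_induction with
      | base => exact fun _ => le_rfl
      | succ k hk ih => exact fun hkc => (ih (by omega)).trans (hprev k (by omega))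
    have hg := hmono c hcM le_rfl
    rcases le_total 0 φ with hφ0 | hφ0
    · have := mul_le_mul_of_nonneg_left hS1 hφ0
      linarith
    · have := mul_nonneg (neg_nonneg.2 hφ0) hS0
      linarith

/-! ### Equilibrium thresholds -/

lemma threshold_of_lt (price : ℝ≥0∞) {share : ℝ≥0∞} (h : share < 1) :
    threshold price share = price / (1 - share) := by
  have hne : 1 - share ≠ 0 := (tsub_pos_of_lt h).ne'
  have hne' : 1 - share ≠ ⊤ := ENNReal.sub_ne_top ENNReal.one_ne_top
  have key : ∀ v, v * share + price ≤ v ↔ price / (1 - share) ≤ v := by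
    intro v
    rcases eq_or_ne v ⊤ with rfl | hv
    · simp
    rw [ENNReal.div_le_iff hne hne']
    have hsplit : v = v * share + v * (1 - share) := by
      rw [← mul_add, add_tsub_cancel_of_le h.le, mul_one]
    have hfin : v * share ≠ ⊤ := ENNReal.mul_ne_top hv (h.trans ENNReal.one_lt_top).ne
    conv_lhs => rhs; rw [hsplit]
    exact ENNReal.add_le_add_iff_left hfin
  simp_rw [threshold, key]
  exact csInf_Ici

lemma threshold_mul (t : ℝ≥0∞) {share : ℝ≥0∞} (h : share < 1) :
    threshold (t * (1 - share)) share = t := by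
  rw [threshold_of_lt _ h]
  exact ENNReal.mul_div_cancel_right (tsub_pos_of_lt h).ne' (ENNReal.sub_ne_top ENNReal.one_ne_top)

lemma threshold_top (share : ℝ≥0∞) : threshold ⊤ share = ⊤ := by
  simp [threshold]

/-- The expected payment equals the expected gain from buying. -/
lemma price_mul_buyProb_threshold (μ : MeasureTheory.Measure ℝ) (price : ℝ≥0∞) {share : ℝ≥0∞}
    (h : share ≤ 1) :
    price * buyProb μ (threshold price share) =
      threshold price share * buyProb μ (threshold price share) * (1 - share) := by
  rcases h.lt_or_eq with h | rfl
  · have : threshold price share * (1 - share) = price := by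
      rw [threshold_of_lt _ h]
      exact ENNReal.div_mul_cancel (tsub_pos_of_lt h).ne' (ENNReal.sub_ne_top ENNReal.one_ne_top)
    rw [mul_right_comm, this]
  -- With share `1` no finite value justifies a positive price: the threshold is `∞` and nobody
  -- buys.
  · rcases eq_or_ne price 0 with rfl | hp
    · simp
    · have : threshold price 1 = ⊤ := by
        refine sInf_eq_top.2 fun v hv => ?_
        by_contra hvt
        rw [Set.mem_ofPred_eq, mul_one] at hv
        exact (ENNReal.lt_add_right hvt hp).not_ge hv
      rw [this, buyProb_top]; simp

/-! ### Probabilities of the sale -/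

lemma finalProb_eq_zero (n : ℕ) (law : ℕ → MeasureTheory.Measure ℝ) (w : ℕ → ℝ≥0)
    (p : ℕ → ℕ → ℝ≥0∞) (m i : ℕ) {j k : ℕ} (h : k < j) : finalProb n law w p m i j k = 0 := by
  induction m generalizing i j with
  | zero => simp [finalProb, h.ne]
  | succ m ih => simp [finalProb, ih _ h, ih _ (h.trans (Nat.lt_succ_self j))]

lemma sum_finalProb {n : ℕ} {law : ℕ → MeasureTheory.Measure ℝ}
    (hlaw : ∀ i, i < n → MeasureTheory.IsProbabilityMeasure (law i)) (w : ℕ → ℝ≥0)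
    (p : ℕ → ℕ → ℝ≥0∞) {m i j : ℕ} (hi : i + m ≤ n) (hj : j + m ≤ n) :
    ∑ l ∈ Finset.range (n + 1), finalProb n law w p m i j l = 1 := by
  induction m generalizing i j with
  | zero => simp [finalProb]; omega
  | succ m ih =>
    have := hlaw i (by omega)
    simp only [finalProb, Finset.sum_add_distrib, ← Finset.mul_sum]
    rw [ih (by omega) (by omega), ih (by omega) (by omega), mul_one, mul_one,
      passProb_add_buyProb]

lemma sum_finalProbAfter {n : ℕ} {law : ℕ → MeasureTheory.Measure ℝ}
    (hlaw : ∀ i, i < n → MeasureTheory.IsProbabilityMeasure (law i)) (w : ℕ → ℝ≥0)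
    (p : ℕ → ℕ → ℝ≥0∞) {i j : ℕ} (hi : i < n) (hj : j ≤ i) :
    ∑ l ∈ Finset.range (n + 1), finalProbAfter n law w p i j l = 1 :=
  sum_finalProb hlaw w p (by omega) (by omega)

lemma reachProb_eq_zero (law : ℕ → MeasureTheory.Measure ℝ) (T : ℕ → ℕ → ℝ≥0∞) {i j : ℕ}
    (h : i < j) : reachProb law T i j = 0 := by
  induction i generalizing j with
  | zero => obtain ⟨j, rfl⟩ := Nat.exists_eq_succ_of_ne_zero h.ne'; rfl
  | succ i ih =>
    obtain ⟨j, rfl⟩ := Nat.exists_eq_succ_of_ne_zero (Nat.ne_of_gt (Nat.zero_lt_of_lt h))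
    simp [reachProb, ih (show i < j + 1 by omega), ih (show i < j by omega)]

/-- One step of the process: expectations of a function of the number of sold units. -/
lemma sum_reachProb_succ (law : ℕ → MeasureTheory.Measure ℝ) (T : ℕ → ℕ → ℝ≥0∞) (f : ℕ → ℝ≥0∞)
    (i : ℕ) :
    ∑ j ∈ Finset.range (i + 2), reachProb law T (i + 1) j * f j =
      ∑ j ∈ Finset.range (i + 1), reachProb law T i j *
        (passProb (law i) (T i j) * f j + buyProb (law i) (T i j) * f (j + 1)) := by
  have hpass : ∑ j ∈ Finset.range (i + 1), reachProb law T i j * (passProb (law i) (T i j) * f j) =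
      ∑ j ∈ Finset.range (i + 1),
        reachProb law T i (j + 1) * (passProb (law i) (T i (j + 1)) * f (j + 1)) +
      reachProb law T i 0 * (passProb (law i) (T i 0) * f 0) := by
    rw [← Finset.sum_range_succ' (fun j => reachProb law T i j * (passProb (law i) (T i j) * f j)),
      Finset.sum_range_succ _ (i + 1), reachProb_eq_zero law T (Nat.lt_succ_self i), zero_mul,
      add_zero]
  simp_rw [mul_add, Finset.sum_add_distrib, hpass]
  rw [Finset.sum_range_succ']
  simp_rw [reachProb, add_mul, Finset.sum_add_distrib, mul_assoc]
  ring

lemma sum_reachProb {n : ℕ} {law : ℕ → MeasureTheory.Measure ℝ}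
    (hlaw : ∀ i, i < n → MeasureTheory.IsProbabilityMeasure (law i)) (T : ℕ → ℕ → ℝ≥0∞) {i : ℕ}
    (hi : i ≤ n) : ∑ j ∈ Finset.range (i + 1), reachProb law T i j = 1 := by
  induction i with
  | zero => simp [reachProb]
  | succ i ih =>
    have := hlaw i hi
    have h := sum_reachProb_succ law T (fun _ => 1) i
    simp only [mul_one] at h
    rw [h, ← ih (by omega)]
    exact Finset.sum_congr rfl fun j _ => by rw [passProb_add_buyProb, mul_one]

/-- The expected number of sold units. -/
lemma sum_reachProb_mul_count {n : ℕ} {law : ℕ → MeasureTheory.Measure ℝ}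
    (hlaw : ∀ i, i < n → MeasureTheory.IsProbabilityMeasure (law i)) (T : ℕ → ℕ → ℝ≥0∞) {i : ℕ}
    (hi : i ≤ n) :
    ∑ j ∈ Finset.range (i + 1), reachProb law T i j * j =
      ∑ i' ∈ Finset.range i, ∑ j ∈ Finset.range (i' + 1),
        reachProb law T i' j * buyProb (law i') (T i' j) := by
  induction i with
  | zero => simp [reachProb]
  | succ i ih =>
    have := hlaw i hi
    rw [sum_reachProb_succ law T (fun j => (j : ℝ≥0∞)) i,
      Finset.sum_range_succ (fun i' => ∑ j ∈ Finset.range (i' + 1), _), ← ih (by omega),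
      ← Finset.sum_add_distrib]
    refine Finset.sum_congr rfl fun j _ => ?_
    rw [← mul_add]
    push_cast
    rw [mul_add (buyProb _ _), ← add_assoc, ← add_mul, passProb_add_buyProb, one_mul, mul_one]

lemma reachProb_stopAfter_eq_zero (law : ℕ → MeasureTheory.Measure ℝ) (p : ℕ → ℕ → ℝ≥0∞)
    {k : ℕ} (i : ℕ) {j : ℕ} (h : k < j) : reachProb law (stopAfter k p) i j = 0 := by
  induction i generalizing j with
  | zero => obtain ⟨j, rfl⟩ := Nat.exists_eq_succ_of_ne_zero (Nat.ne_of_gt (Nat.zero_lt_of_lt h)); rfl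
  | succ i ih =>
    obtain ⟨j, rfl⟩ := Nat.exists_eq_succ_of_ne_zero (Nat.ne_of_gt (Nat.zero_lt_of_lt h))
    have : stopAfter k p i j = ⊤ := if_neg (by omega)
    simp [reachProb, ih h, this, buyProb_top]

lemma reachProb_stopAfter (law : ℕ → MeasureTheory.Measure ℝ) (p : ℕ → ℕ → ℝ≥0∞)
    {k : ℕ} (i : ℕ) {j : ℕ} (h : j < k) :
    reachProb law (stopAfter k p) i j = reachProb law p i j := by
  induction i generalizing j with
  | zero => cases j <;> rfl
  | succ i ih =>
    cases j with
    | zero => simp [reachProb, ih h, stopAfter, h]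
    | succ j => simp [reachProb, ih h, ih (Nat.lt_of_succ_lt h), stopAfter, h, Nat.lt_of_succ_lt h]

/-! ### Decomposition of the revenue -/

lemma add_sum_increments {w : ℕ → ℝ≥0} (hw : Monotone w) {a b : ℕ} (h : a ≤ b) :
    w a + ∑ k ∈ Finset.Ioc a b, (w k - w (k - 1)) = w b := by
  induction b, h using Nat.le_induction with
  | base => simp
  | succ b hab ih =>
    rw [← Finset.insert_Ioc_right_eq_Ioc_add_one (by omega), Finset.sum_insert (by simp),
      add_left_comm, ih, Nat.add_sub_cancel]
    exact tsub_add_cancel_of_le (hw (Nat.le_succ b))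

lemma IsAvailability.le_one {n : ℕ} {w : ℕ → ℝ≥0} (hw : IsAvailability n w) (k : ℕ) : w k ≤ 1 :=
  (hw.2.1 (le_max_left k n)).trans (hw.2.2 _ (le_max_right k n)).le

lemma share_le_one {n : ℕ} {law : ℕ → MeasureTheory.Measure ℝ} {w : ℕ → ℝ≥0}
    (hlaw : ∀ i, i < n → MeasureTheory.IsProbabilityMeasure (law i)) (hw : IsAvailability n w)
    (p : ℕ → ℕ → ℝ≥0∞) {i j : ℕ} (hi : i < n) (hj : j ≤ i) :
    ∑ l ∈ Finset.range (n + 1), (w l : ℝ≥0∞) * finalProbAfter n law w p i j l ≤ 1 := by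
  rw [← sum_finalProbAfter hlaw w p hi hj]
  exact Finset.sum_le_sum fun l _ => mul_le_of_le_one_left' (by exact_mod_cast hw.le_one l)

/-- Since `w n = 1`, the increments `w k - w (k - 1)` over `l < k ≤ n` telescope to `1 - w l`;
average this over the final count `l` and exchange the sums. -/
lemma one_sub_share {n : ℕ} {law : ℕ → MeasureTheory.Measure ℝ} {w : ℕ → ℝ≥0}
    (hlaw : ∀ i, i < n → MeasureTheory.IsProbabilityMeasure (law i)) (hw : IsAvailability n w)
    (p : ℕ → ℕ → ℝ≥0∞) {i j : ℕ} (hi : i < n) (hj : j ≤ i) :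
    1 - ∑ l ∈ Finset.range (n + 1), (w l : ℝ≥0∞) * finalProbAfter n law w p i j l =
      ∑ k ∈ Finset.Icc 1 n, ((w k - w (k - 1) : ℝ≥0) : ℝ≥0∞) *
        ∑ l ∈ Finset.range k, finalProbAfter n law w p i j l := by
  set r := finalProbAfter n law w p i j
  have hle := share_le_one hlaw hw p hi hj
  refine (ENNReal.eq_sub_of_add_eq (ne_top_of_le_ne_top ENNReal.one_ne_top hle) ?_).symm
  have hinner : ∀ k ∈ Finset.Icc 1 n, ((w k - w (k - 1) : ℝ≥0) : ℝ≥0∞) * ∑ l ∈ Finset.range k, r l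
      = ∑ l ∈ Finset.range (n + 1), if l < k then ((w k - w (k - 1) : ℝ≥0) : ℝ≥0∞) * r l else 0 := by
    intro k hk
    rw [← Finset.sum_filter, Finset.mul_sum]
    refine Finset.sum_congr ?_ fun _ _ => rfl
    ext l
    simp only [Finset.mem_range, Finset.mem_filter, Finset.mem_Icc] at hk ⊢
    omega
  rw [Finset.sum_congr rfl hinner, Finset.sum_comm, ← Finset.sum_add_distrib,
    ← sum_finalProbAfter hlaw w p hi hj]
  refine Finset.sum_congr rfl fun l hl => ?_
  rw [← Finset.sum_filter, ← Finset.sum_mul, ← add_mul]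
  have hset : (Finset.Icc 1 n).filter (fun k => l < k) = Finset.Ioc l n := by
    ext k
    simp only [Finset.mem_filter, Finset.mem_Icc, Finset.mem_Ioc]
    omega
  have := add_sum_increments hw.2.1 (Nat.le_of_lt_succ (Finset.mem_range.1 hl))
  rw [hset, add_comm, ← ENNReal.ofNNReal_finsetSum, ← ENNReal.coe_add, this, hw.2.2 n le_rfl,
    ENNReal.coe_one, one_mul]

theorem revenue_eq_sum_component {n : ℕ} {law : ℕ → MeasureTheory.Measure ℝ} {w : ℕ → ℝ≥0}
    (hlaw : ∀ i, i < n → MeasureTheory.IsProbabilityMeasure (law i)) (hw : IsAvailability n w)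
    (p : ℕ → ℕ → ℝ≥0∞) :
    revenue n law w p =
      ∑ k ∈ Finset.Icc 1 n, ((w k - w (k - 1) : ℝ≥0) : ℝ≥0∞) * component n law w p k := by
  simp_rw [component, fun (f : ℕ → ℝ≥0∞) b => Finset.mul_sum (Finset.range n) f b]
  rw [Finset.sum_comm, revenue, saleRevenue]
  refine Finset.sum_congr rfl fun i hi => ?_
  rw [Finset.mem_range] at hi
  -- The ranges `j < k` and `j ≤ i` are interchangeable: states `j > i` are unreachable, and from `j
  -- ≥ k` the final count cannot be below `k`.
  have hext : ∀ k, ∑ j ∈ Finset.range k, reachProb law (eqThreshold n law w p) i j *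
        (eqThreshold n law w p i j * buyProb (law i) (eqThreshold n law w p i j)) *
        ∑ l ∈ Finset.range k, finalProbAfter n law w p i j l =
      ∑ j ∈ Finset.range (i + 1), reachProb law (eqThreshold n law w p) i j *
        (eqThreshold n law w p i j * buyProb (law i) (eqThreshold n law w p i j)) *
        ∑ l ∈ Finset.range k, finalProbAfter n law w p i j l := by
    intro k
    rw [Finset.sum_subset (Finset.range_mono (Nat.le_add_right k (i + 1))),
      ← Finset.sum_subset (Finset.range_mono (Nat.le_add_left (i + 1) k))]
    · intro j _ hj
      rw [reachProb_eq_zero _ _ (by simpa using hj), zero_mul, zero_mul]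
    · intro j _ hj
      rw [Finset.sum_eq_zero (s := Finset.range k), mul_zero]
      intro l hl
      rw [Finset.mem_range] at hl hj
      exact finalProb_eq_zero n law w p _ _ (by omega)
  simp_rw [hext, fun (f : ℕ → ℝ≥0∞) b => Finset.mul_sum (Finset.range (i + 1)) f b]
  rw [Finset.sum_comm]
  refine Finset.sum_congr rfl fun j hj => ?_
  have hji : j ≤ i := Nat.le_of_lt_succ (Finset.mem_range.1 hj)
  have h1 := price_mul_buyProb_threshold (law i) (p i j) (share_le_one hlaw hw p hi hji)
  rw [one_sub_share hlaw hw p hi hji] at h1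
  change _ * (p i j * buyProb (law i) (threshold (p i j) _)) = _
  rw [h1, ← mul_assoc, Finset.mul_sum]
  exact Finset.sum_congr rfl fun k _ => mul_left_comm _ _ _

/-- Use the equilibrium thresholds as private prices and stop after `k` sales. States below `k` are
reached with unchanged probabilities, and the factor `r^{<k}` is at most `1`. -/
theorem component_le_optPrivate {n : ℕ} {law : ℕ → MeasureTheory.Measure ℝ}
    (hlaw : ∀ i, i < n → MeasureTheory.IsProbabilityMeasure (law i)) (w : ℕ → ℝ≥0)
    (p : ℕ → ℕ → ℝ≥0∞) {k : ℕ} (hk : k ≤ n) :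
    component n law w p k ≤ optPrivate n law k := by
  refine le_trans ?_ (le_iSup _ (eqThreshold n law w p))
  refine Finset.sum_le_sum fun i hi => ?_
  rw [Finset.mem_range] at hi
  have hle : ∀ j ∈ Finset.range k, reachProb law (eqThreshold n law w p) i j *
        (eqThreshold n law w p i j * buyProb (law i) (eqThreshold n law w p i j)) *
        ∑ l ∈ Finset.range k, finalProbAfter n law w p i j l ≤
      reachProb law (stopAfter k (eqThreshold n law w p)) i j *
        (stopAfter k (eqThreshold n law w p) i j *
          buyProb (law i) (stopAfter k (eqThreshold n law w p) i j)) := by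
    intro j hj
    rw [Finset.mem_range] at hj
    rw [reachProb_stopAfter _ _ _ hj, stopAfter, if_pos hj]
    rcases lt_or_ge i j with hij | hij
    · simp [reachProb_eq_zero _ _ hij]
    · refine mul_le_of_le_one_right' ?_
      rw [← sum_finalProbAfter hlaw w p hi hij]
      exact Finset.sum_le_sum_of_subset (Finset.range_mono (by omega))
  refine (Finset.sum_le_sum hle).trans ?_
  refine (Finset.sum_le_sum_of_subset (Finset.range_mono (Nat.le_add_right k (i + 1)))).trans ?_
  rw [← Finset.sum_subset (Finset.range_mono (Nat.le_add_left (i + 1) k))]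
  intro j _ hj
  rw [reachProb_eq_zero _ _ (by simpa using hj), zero_mul]

lemma optPrivate_mono (n : ℕ) (law : ℕ → MeasureTheory.Measure ℝ) : Monotone (optPrivate n law) := by
  intro k k' h
  refine iSup_le fun p => ?_
  have : stopAfter k p = stopAfter k' (stopAfter k p) := by
    funext i j
    by_cases hj : j < k
    · simp [stopAfter, hj, hj.trans_le h]
    · simp [stopAfter, hj]
  rw [this]
  exact le_iSup (fun p => saleRevenue n law (stopAfter k' p) (stopAfter k' p)) _

/-- On the block from `2 ^ l` to `2 ^ (l + 1) - 1`, replace each private optimum by the one at the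
right end, by monotonicity, and telescope the weights. -/
theorem revenue_le_dyadic {n : ℕ} {law : ℕ → MeasureTheory.Measure ℝ} {w : ℕ → ℝ≥0}
    (hlaw : ∀ i, i < n → MeasureTheory.IsProbabilityMeasure (law i)) (hw : IsAvailability n w)
    (p : ℕ → ℕ → ℝ≥0∞) :
    revenue n law w p ≤
      ∑ l ∈ Finset.range (Nat.log 2 n + 1),
        ((w (2 ^ (l + 1) - 1) - w (2 ^ l - 1) : ℝ≥0) : ℝ≥0∞) *
          optPrivate n law (min (2 ^ (l + 1) - 1) n) := by
  rw [revenue_eq_sum_component hlaw hw]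
  set d : ℕ → ℝ≥0∞ := fun k => ((w k - w (k - 1) : ℝ≥0) : ℝ≥0∞)
  have hpow : ∀ l, 2 ^ l - 1 ≤ 2 ^ (l + 1) - 1 := fun l =>
    Nat.sub_le_sub_right (Nat.pow_le_pow_right (by norm_num) (Nat.le_succ l)) 1
  have hgroup : ∀ L (G : ℕ → ℝ≥0∞), ∑ k ∈ Finset.Ioc 0 (2 ^ L - 1), G k =
      ∑ l ∈ Finset.range L, ∑ k ∈ Finset.Ioc (2 ^ l - 1) (2 ^ (l + 1) - 1), G k := by
    intro L G
    induction L with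
    | zero => simp
    | succ L ih =>
      rw [Finset.sum_range_succ, ← ih, ← Finset.sum_union]
      · congr 1
        ext k
        have := hpow L
        simp only [Finset.mem_union, Finset.mem_Ioc]
        omega
      · rw [Finset.disjoint_left]
        intro k
        simp only [Finset.mem_Ioc]
        omega
  have hn : n ≤ 2 ^ (Nat.log 2 n + 1) - 1 :=
    Nat.le_sub_one_of_lt (Nat.lt_pow_succ_log_self (by norm_num) n)
  have hd : ∀ k, n < k → d k = 0 := fun k hk => by
    simp [d, hw.2.2 k hk.le, hw.2.2 (k - 1) (by omega)]
  calc ∑ k ∈ Finset.Icc 1 n, d k * component n law w p k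
      ≤ ∑ k ∈ Finset.Icc 1 n, d k * optPrivate n law (min k n) := by
        refine Finset.sum_le_sum fun k hk => mul_le_mul_right ?_ _
        rw [min_eq_left (Finset.mem_Icc.1 hk).2]
        exact component_le_optPrivate hlaw w p (Finset.mem_Icc.1 hk).2
    -- The last block may run past `n`; the added terms are non-negative, and `min k n` keeps the
    -- number of units at most `n`.
    _ ≤ ∑ k ∈ Finset.Ioc 0 (2 ^ (Nat.log 2 n + 1) - 1), d k * optPrivate n law (min k n) := by
        refine Finset.sum_le_sum_of_subset fun k hk => ?_
        simp only [Finset.mem_Icc, Finset.mem_Ioc] at hk ⊢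
        omega
    _ = _ := hgroup _ _
    _ ≤ _ := by
        refine Finset.sum_le_sum fun l _ => ?_
        have := add_sum_increments hw.2.1 (hpow l)
        rw [← eq_tsub_of_add_eq ((add_comm _ _).trans this), ENNReal.ofNNReal_finsetSum,
          Finset.sum_mul]
        refine Finset.sum_le_sum fun k hk => mul_le_mul_right ?_ _
        exact optPrivate_mono n law (min_le_min_right n (Finset.mem_Ioc.1 hk).2)

/-! ### The ex-ante bound on private sales -/

/-- Lagrangian bound: if selling to agent `i` at any price earns at most `A i` plus `L` per expected
unit, then a sale of `K` units earns at most `∑ A i + L * K`. -/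
theorem optPrivate_le_of_multiplier {n : ℕ} {law : ℕ → MeasureTheory.Measure ℝ}
    (hlaw : ∀ i, i < n → MeasureTheory.IsProbabilityMeasure (law i)) (K : ℕ) (A : ℕ → ℝ≥0∞)
    (L : ℝ≥0∞)
    (h : ∀ i < n, ∀ t, t * buyProb (law i) t ≤ A i + L * buyProb (law i) t) :
    optPrivate n law K ≤ ∑ i ∈ Finset.range n, A i + L * K := by
  refine iSup_le fun p => ?_
  set T := stopAfter K p with hT
  calc saleRevenue n law T T
      ≤ ∑ i ∈ Finset.range n, ∑ j ∈ Finset.range (i + 1),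
          reachProb law T i j * (A i + L * buyProb (law i) (T i j)) :=
        Finset.sum_le_sum fun i hi => Finset.sum_le_sum fun j _ =>
          mul_le_mul_right (h i (Finset.mem_range.1 hi) _) _
    -- The purchase probabilities add up to the expected number of units sold, which cannot exceed
    -- `K` because the sale stops there.
    _ = ∑ i ∈ Finset.range n, A i + L * ∑ j ∈ Finset.range (n + 1), reachProb law T n j * j := by
        rw [sum_reachProb_mul_count hlaw T le_rfl, Finset.mul_sum, ← Finset.sum_add_distrib]
        refine Finset.sum_congr rfl fun i hi => ?_
        simp_rw [mul_add, Finset.sum_add_distrib, ← Finset.sum_mul,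
          sum_reachProb hlaw T (Finset.mem_range.1 hi).le, one_mul, Finset.mul_sum,
          mul_left_comm L]
    _ ≤ _ := by
        gcongr
        calc ∑ j ∈ Finset.range (n + 1), reachProb law T n j * (j : ℝ≥0∞)
            ≤ ∑ j ∈ Finset.range (n + 1), reachProb law T n j * (K : ℝ≥0∞) := by
              refine Finset.sum_le_sum fun j _ => ?_
              rcases le_or_gt j K with hj | hj
              · gcongr
              · rw [hT, reachProb_stopAfter_eq_zero law p n hj, zero_mul, zero_mul]
          _ = K := by rw [← Finset.sum_mul, sum_reachProb hlaw T le_rfl, one_mul]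

/-! ### The greedy allocation of selling probabilities -/

/-- The ex-ante revenue when agent `i` buys with probability `c i / (4 n)`. -/
def allocRevenue (n : ℕ) (law : ℕ → MeasureTheory.Measure ℝ) (c : ℕ → ℕ) : ℝ :=
  ∑ i ∈ Finset.range n, gridRevenue (law i) (4 * n) (c i)

/-- The gain from one more grid step for agent `i`. -/
def marginal (n : ℕ) (law : ℕ → MeasureTheory.Measure ℝ) (c : ℕ → ℕ) (i : ℕ) : ℝ :=
  gridRevenue (law i) (4 * n) (c i + 1) - gridRevenue (law i) (4 * n) (c i)

/-- `c` arises from at most `b` greedy steps. -/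
def GreedyAlloc (n : ℕ) (law : ℕ → MeasureTheory.Measure ℝ) (c : ℕ → ℕ) (b : ℕ) : Prop :=
  ∑ i ∈ Finset.range n, c i ≤ b ∧
  (∀ i < n, c i < 4 * n ∧
    ∀ k < c i, gridRevenue (law i) (4 * n) k ≤ gridRevenue (law i) (4 * n) (k + 1)) ∧
  ∃ lam : ℝ, 0 ≤ lam ∧ lam * b ≤ allocRevenue n law c ∧ ∀ i < n, marginal n law c i ≤ lam

lemma allocRevenue_nonneg {n : ℕ} {law : ℕ → MeasureTheory.Measure ℝ}
    (hreg : ∀ i, i < n → IsRegular (law i)) (c : ℕ → ℕ) : 0 ≤ allocRevenue n law c :=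
  Finset.sum_nonneg fun i hi => by
    rw [Finset.mem_range] at hi
    exact (hreg i hi).gridRevenue_nonneg (by omega) _

lemma greedyAlloc_zero {n : ℕ} {law : ℕ → MeasureTheory.Measure ℝ}
    (hreg : ∀ i, i < n → IsRegular (law i)) : GreedyAlloc n law (fun _ => 0) 0 := by
  have hnn : ∀ i ∈ Finset.range n, 0 ≤ gridRevenue (law i) (4 * n) 1 := fun i hi => by
    rw [Finset.mem_range] at hi
    exact (hreg i hi).gridRevenue_nonneg (by omega) _
  refine ⟨by simp, fun i hi => ⟨show 0 < 4 * n by omega, by simp⟩,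
    -- With no steps made, the multiplier only has to dominate all marginals; their sum does.
    ∑ i ∈ Finset.range n, gridRevenue (law i) (4 * n) 1, Finset.sum_nonneg hnn, ?_, ?_⟩
  · simp [allocRevenue]
  · intro i hi
    simpa [marginal] using Finset.single_le_sum hnn (Finset.mem_range.2 hi)

lemma GreedyAlloc.stay {n : ℕ} {law : ℕ → MeasureTheory.Measure ℝ}
    (hreg : ∀ i, i < n → IsRegular (law i)) {c : ℕ → ℕ} {b : ℕ} (h : GreedyAlloc n law c b)
    (hm : ∀ i < n, marginal n law c i ≤ 0) : GreedyAlloc n law c (b + 1) :=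
  ⟨h.1.trans (Nat.le_succ b), h.2.1, 0, le_rfl, by
    simpa using allocRevenue_nonneg hreg c, hm⟩

lemma allocRevenue_update {n : ℕ} (law : ℕ → MeasureTheory.Measure ℝ) (c : ℕ → ℕ) {i₀ : ℕ}
    (hi₀ : i₀ < n) :
    allocRevenue n law (Function.update c i₀ (c i₀ + 1)) =
      allocRevenue n law c + marginal n law c i₀ := by
  have hmem := Finset.mem_range.2 hi₀
  rw [allocRevenue, allocRevenue, ← Finset.add_sum_erase _ _ hmem, ← Finset.add_sum_erase _ _ hmem,
    Finset.sum_congr rfl (g := fun i => gridRevenue (law i) (4 * n) (c i))]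
  · simp only [Function.update_self, marginal]; ring
  · intro i hi
    rw [Function.update_of_ne (Finset.ne_of_mem_erase hi)]

/-- The largest marginal `m` is at most the old multiplier, so `m * b ≤ V`, and the step itself adds
`m`, giving `m * (b + 1) ≤ V + m`. By concavity the next marginal of `i₀` is again at most `m`, so
`m` is the new multiplier. -/
lemma GreedyAlloc.step {n : ℕ} {law : ℕ → MeasureTheory.Measure ℝ}
    (hreg : ∀ i, i < n → IsRegular (law i)) {c : ℕ → ℕ} {b i₀ : ℕ} (h : GreedyAlloc n law c b)
    (hi₀ : i₀ < n) (hpos : 0 < marginal n law c i₀)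
    (hmax : ∀ i < n, marginal n law c i ≤ marginal n law c i₀) :
    GreedyAlloc n law (Function.update c i₀ (c i₀ + 1)) (b + 1) := by
  obtain ⟨hsum, hc, lam, hlam, hV, hnext⟩ := h
  have hN : 0 < 4 * n := by omega
  -- A step to selling probability `1` would lead to revenue `0`, so its marginal would not be
  -- positive.
  have hlt : c i₀ + 1 < 4 * n := by
    by_contra! hge
    have := (hreg i₀ hi₀).gridRevenue_nonneg hN (c i₀)
    rw [marginal, gridRevenue_of_le _ hN hge] at hpos
    linarith
  refine ⟨?_, fun i hi => ?_, marginal n law c i₀, hpos.le, ?_, fun i hi => ?_⟩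
  · have hmem := Finset.mem_range.2 hi₀
    rw [← Finset.add_sum_erase _ _ hmem] at hsum ⊢
    rw [Finset.sum_congr rfl (g := fun i => c i), Function.update_self]
    · omega
    · intro i hi
      rw [Function.update_of_ne (Finset.ne_of_mem_erase hi)]
  · rcases eq_or_ne i i₀ with rfl | hne
    · rw [Function.update_self]
      refine ⟨hlt, fun k hk => ?_⟩
      rcases (Nat.le_of_lt_succ hk).lt_or_eq with hk | rfl
      · exact (hc i hi).2 k hk
      · have : 0 < gridRevenue (law i) (4 * n) (c i + 1) - _ := hpos
        linarith
    · rw [Function.update_of_ne hne]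
      exact hc i hi
  · rw [allocRevenue_update law c hi₀]
    have h1 : marginal n law c i₀ * b ≤ lam * b :=
      mul_le_mul_of_nonneg_right (hnext i₀ hi₀) (Nat.cast_nonneg b)
    push_cast
    linarith
  · rcases eq_or_ne i i₀ with rfl | hne
    · have : marginal n law (Function.update c i (c i + 1)) i =
          gridRevenue (law i) (4 * n) (c i + 2) - gridRevenue (law i) (4 * n) (c i + 1) := by
        rw [marginal, Function.update_self]
      rw [this]
      exact (hreg i hi).gridRevenue_concave (by omega)
    · have : marginal n law (Function.update c i₀ (c i₀ + 1)) i = marginal n law c i := by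
        rw [marginal, marginal, Function.update_of_ne hne]
      rw [this]
      exact hmax i hi

open ProbabilityTheory in
/-- The greedy allocation for `u` units is within a constant factor of the best private sale of
up to `3 u` units. -/
theorem GreedyAlloc.optPrivate_le {n : ℕ} {law : ℕ → MeasureTheory.Measure ℝ}
    (hreg : ∀ i, i < n → IsRegular (law i)) {c : ℕ → ℕ} {u K : ℕ}
    (h : GreedyAlloc n law c (2 * n * u)) (hu : 1 ≤ u) (hK : K ≤ 3 * u) :
    optPrivate n law K ≤ ENNReal.ofReal (9 * allocRevenue n law c) := by
  obtain ⟨-, hc, lam, hlam, hV, hnext⟩ := h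
  have hnn : ∀ i ∈ Finset.range n, 0 ≤ 2 * (gridRevenue (law i) (4 * n) (c i) + lam) :=
    fun i hi => by
      rw [Finset.mem_range] at hi
      have := (hreg i hi).gridRevenue_nonneg (N := 4 * n) (by omega) (c i)
      positivity
  have hN : 4 * n = 2 * (2 * n) := by ring
  refine (optPrivate_le_of_multiplier (fun i hi => (hreg i hi).1) K
    (fun i => ENNReal.ofReal (2 * (gridRevenue (law i) (4 * n) (c i) + lam)))
    (ENNReal.ofReal (4 * n * lam)) fun i hi t => ?_).trans ?_
  · rcases eq_or_ne t ⊤ with rfl | ht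
    · simp [buyProb_top]
    obtain ⟨v, hv, rfl⟩ : ∃ v : ℝ, 0 ≤ v ∧ t = ENNReal.ofReal v :=
      ⟨t.toReal, ENNReal.toReal_nonneg, (ENNReal.ofReal_toReal ht).symm⟩
    have hS : 0 ≤ 1 - cdf (law i) v := by linarith [cdf_le_one (law i) v]
    rw [(hreg i hi).buyProb_ofReal hv, ← ENNReal.ofReal_mul hv, ← ENNReal.ofReal_mul (by positivity),
      ← ENNReal.ofReal_add (hnn i (Finset.mem_range.2 hi)) (by positivity)]
    refine ENNReal.ofReal_le_ofReal ?_
    have h1 := hnext i hi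
    have h2 := (hc i hi).2
    rw [marginal] at h1
    rw [hN] at h1 h2 ⊢
    have := (hreg i hi).revenue_le_of_marginal_le (by omega) hlam h1 h2 v
    push_cast at this
    linarith
  · rw [← ENNReal.ofReal_sum_of_nonneg hnn, ← ENNReal.ofReal_natCast K,
      ← ENNReal.ofReal_mul (by positivity), ← ENNReal.ofReal_add (Finset.sum_nonneg hnn)
      (by positivity)]
    refine ENNReal.ofReal_le_ofReal ?_
    rw [← Finset.mul_sum, Finset.sum_add_distrib, Finset.sum_const, Finset.card_range, nsmul_eq_mul]
    -- From `2 n u lam ≤ V` with `u ≥ 1` and `K ≤ 3 u`, the three contributions are at most `2 V`,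
    -- `V` and `6 V`.
    change 2 * (allocRevenue n law c + n * lam) + 4 * n * lam * K ≤ 9 * allocRevenue n law c
    have hu' : (1 : ℝ) ≤ u := by exact_mod_cast hu
    have hK' : (K : ℝ) ≤ 3 * u := by exact_mod_cast hK
    have hnl : 0 ≤ n * lam := by positivity
    push_cast at hV
    have h1 : n * lam * 1 ≤ n * lam * u := mul_le_mul_of_nonneg_left hu' hnl
    have h2 : n * lam * K ≤ n * lam * (3 * u) := mul_le_mul_of_nonneg_left hK' hnl
    linarith

/-! ### Prices that implement an allocation -/

/-- Agent `i` is served in state `j` of a sale of at most `u` units. -/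
def Served (c : ℕ → ℕ) (u i j : ℕ) : Prop := j + 1 ≤ u ∧ 1 ≤ c i

open Classical in
/-- The threshold at which a served agent `i` buys with probability `c i / (4 n)`. -/
def allocThreshold (n : ℕ) (law : ℕ → MeasureTheory.Measure ℝ) (c : ℕ → ℕ) (u i j : ℕ) : ℝ≥0∞ :=
  if Served c u i j then ENNReal.ofReal (quantile (law i) (1 - c i / (4 * n))) else ⊤

open Classical in
/-- The expected final availability when `m` agents are still to come, `i` is the next one and `j`
agents have bought. -/
def allocShare (n : ℕ) (w : ℕ → ℝ≥0) (c : ℕ → ℕ) (u : ℕ) : ℕ → ℕ → ℕ → ℝ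
  | 0, _, j => w j
  | m + 1, i, j =>
    if Served c u i j then
      (1 - c i / (4 * n)) * allocShare n w c u m (i + 1) j +
        c i / (4 * n) * allocShare n w c u m (i + 1) (j + 1)
    else allocShare n w c u m (i + 1) j

open Classical in
/-- The price that induces `allocThreshold`. -/
def allocPrice (n : ℕ) (law : ℕ → MeasureTheory.Measure ℝ) (w : ℕ → ℝ≥0) (c : ℕ → ℕ)
    (u i j : ℕ) : ℝ≥0∞ :=
  if Served c u i j then
    ENNReal.ofReal (quantile (law i) (1 - c i / (4 * n)) *
      (1 - allocShare n w c u (n - (i + 1)) (i + 1) j))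
  else ⊤

/-- The discount factor in the revenue guarantee for `u` units. -/
def discount (w : ℕ → ℝ≥0) (u : ℕ) : ℝ := 1 - w (u - (2 - u))

/-- The conditions on an allocation for a sale of at most `u` units. -/
structure Feasible (n : ℕ) (c : ℕ → ℕ) (u : ℕ) : Prop where
  pos : 1 ≤ u
  le : u ≤ n
  lt_grid : ∀ i < n, c i < 4 * n
  sum_le : ∑ i ∈ Finset.range n, c i ≤ 2 * n * u

lemma Feasible.frac {n : ℕ} {c : ℕ → ℕ} {u : ℕ} (h : Feasible n c u) {i : ℕ} (hi : i < n) :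
    0 ≤ (c i / (4 * n) : ℝ) ∧ (c i / (4 * n) : ℝ) < 1 := by
  have hn : (0 : ℝ) < 4 * n := by
    have : 0 < n := by omega
    positivity
  refine ⟨by positivity, ?_⟩
  rw [div_lt_one hn]
  exact_mod_cast h.lt_grid i hi

lemma Feasible.sum_frac_le {n : ℕ} {c : ℕ → ℕ} {u : ℕ} (h : Feasible n c u) :
    ∑ i ∈ Finset.range n, (c i / (4 * n) : ℝ) ≤ u / 2 := by
  have hn : (0 : ℝ) < n := by exact_mod_cast h.pos.trans h.le
  rw [← Finset.sum_div, div_le_div_iff₀ (by positivity) (by positivity)]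
  have : ((∑ i ∈ Finset.range n, c i : ℕ) : ℝ) ≤ 2 * n * u := by exact_mod_cast h.sum_le
  push_cast at this
  linarith

/-- Nobody is served once `u` units are sold, so from `j ≤ u` the final availability never exceeds
`w u`. -/
lemma allocShare_mem_Icc {n : ℕ} {w : ℕ → ℝ≥0} (hw : IsAvailability n w) {c : ℕ → ℕ} {u : ℕ}
    (h : Feasible n c u) {m i : ℕ} (hm : i + m ≤ n) (j : ℕ) :
    0 ≤ allocShare n w c u m i j ∧ (j ≤ u → allocShare n w c u m i j ≤ w u) ∧
      allocShare n w c u m i j ≤ 1 := by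
  induction m generalizing i j with
  | zero => exact ⟨(w j).2, fun hj => NNReal.coe_le_coe.2 (hw.2.1 hj), by
      exact_mod_cast hw.le_one j⟩
  | succ m ih =>
    obtain ⟨h0, h1⟩ := h.frac (show i < n by omega)
    obtain ⟨a0, a1, a2⟩ := ih (i := i + 1) (by omega) j
    obtain ⟨b0, b1, b2⟩ := ih (i := i + 1) (by omega) (j + 1)
    rw [allocShare]
    split_ifs with hs
    · set q := (c i / (4 * n) : ℝ)
      have e0 := mul_nonneg (sub_nonneg.2 h1.le) a0
      have e1 := mul_nonneg h0 b0
      refine ⟨by linarith, fun hj => ?_, ?_⟩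
      · have f0 := mul_le_mul_of_nonneg_left (a1 hj) (sub_nonneg.2 h1.le)
        have f1 := mul_le_mul_of_nonneg_left (b1 hs.1) h0
        linarith
      · have f0 := mul_le_mul_of_nonneg_left a2 (sub_nonneg.2 h1.le)
        have f1 := mul_le_mul_of_nonneg_left b2 h0
        linarith
    · exact ⟨a0, a1, a2⟩

/-- A union bound: as `w 0 = 0`, availability is positive only if one of the remaining agents buys.
-/
lemma allocShare_one_le {n : ℕ} {w : ℕ → ℝ≥0} (hw : IsAvailability n w) {c : ℕ → ℕ}
    (h : Feasible n c 1) {m i : ℕ} (hm : i + m ≤ n) :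
    allocShare n w c 1 m i 0 ≤ ∑ k ∈ Finset.range m, (c (i + k) / (4 * n) : ℝ) := by
  induction m generalizing i with
  | zero => simp [allocShare, hw.1]
  | succ m ih =>
    obtain ⟨h0, h1⟩ := h.frac (show i < n by omega)
    have a := ih (i := i + 1) (by omega)
    obtain ⟨a0, -, -⟩ := allocShare_mem_Icc hw h (show i + 1 + m ≤ n by omega) 0
    obtain ⟨-, -, b2⟩ := allocShare_mem_Icc hw h (show i + 1 + m ≤ n by omega) 1
    rw [Finset.sum_range_succ', allocShare, add_zero]
    have hshift : ∑ k ∈ Finset.range m, (c (i + (k + 1)) / (4 * n) : ℝ) =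
        ∑ k ∈ Finset.range m, (c (i + 1 + k) / (4 * n) : ℝ) :=
      Finset.sum_congr rfl fun k _ => by rw [show i + (k + 1) = i + 1 + k by omega]
    rw [hshift]
    split_ifs with hs
    · have e1 := mul_nonneg h0 a0
      have e2 := mul_le_mul_of_nonneg_left b2 h0
      rw [zero_add]
      linarith
    · linarith

/-- The truncated index `u - (2 - u)` in `discount` is `0` for `u = 1` and `u` for `u ≥ 2`. The
union bound with total probability at most `1 / 2` handles `u = 1`; otherwise the share is at most
`w u`. -/
lemma discount_le {n : ℕ} {w : ℕ → ℝ≥0} (hw : IsAvailability n w) {c : ℕ → ℕ} {u : ℕ}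
    (h : Feasible n c u) {m i j : ℕ} (hm : i + m = n) (hj : j + 1 ≤ u) :
    discount w u / 2 ≤ 1 - allocShare n w c u m i j := by
  have hw1 := hw.le_one u
  have hw1' : (w u : ℝ) ≤ 1 := by exact_mod_cast hw1
  rcases h.pos.eq_or_lt with rfl | hu
  · obtain rfl : j = 0 := by omega
    have h1 := allocShare_one_le hw h hm.le
    have h2 : ∑ k ∈ Finset.range m, (c (i + k) / (4 * n) : ℝ) ≤
        ∑ k ∈ Finset.range n, (c k / (4 * n) : ℝ) := by
      rw [← hm, Finset.sum_range_add]
      refine le_add_of_nonneg_left (Finset.sum_nonneg fun _ _ => by positivity)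
    have h3 := h.sum_frac_le
    rw [discount, show 1 - (2 - 1) = 0 from rfl, hw.1]
    push_cast at h3 ⊢
    linarith
  · have := (allocShare_mem_Icc hw h hm.le j).2.1 (by omega)
    rw [discount, show u - (2 - u) = u by omega]
    linarith

lemma buyProb_allocThreshold {n : ℕ} {law : ℕ → MeasureTheory.Measure ℝ}
    (hreg : ∀ i, i < n → IsRegular (law i)) {c : ℕ → ℕ} {u i j : ℕ} (h : Feasible n c u)
    (hi : i < n) (hs : Served c u i j) :
    buyProb (law i) (allocThreshold n law c u i j) = ENNReal.ofReal (c i / (4 * n)) := by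
  have hg := grid_mem_Ioo (N := 4 * n) hs.2 (h.lt_grid i hi)
  push_cast at hg
  rw [allocThreshold, if_pos hs,
    (hreg i hi).buyProb_ofReal ((hreg i hi).quantile_pos hg.1 hg.2).le,
    (hreg i hi).cdf_quantile hg.1 hg.2, sub_sub_cancel]

lemma passProb_allocThreshold {n : ℕ} {law : ℕ → MeasureTheory.Measure ℝ}
    (hreg : ∀ i, i < n → IsRegular (law i)) {c : ℕ → ℕ} {u i j : ℕ} (h : Feasible n c u)
    (hi : i < n) (hs : Served c u i j) :
    passProb (law i) (allocThreshold n law c u i j) = ENNReal.ofReal (1 - c i / (4 * n)) := by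
  have := (hreg i hi).1
  have hadd := passProb_add_buyProb (law i) (allocThreshold n law c u i j)
  rw [buyProb_allocThreshold hreg h hi hs] at hadd
  obtain ⟨h0, h1⟩ := h.frac hi
  rw [ENNReal.ofReal_sub _ h0, ENNReal.ofReal_one]
  exact ENNReal.eq_sub_of_add_eq ENNReal.ofReal_ne_top hadd

lemma threshold_allocPrice {n : ℕ} {law : ℕ → MeasureTheory.Measure ℝ}
    {w : ℕ → ℝ≥0} (hw : IsAvailability n w) {c : ℕ → ℕ}
    {u i j : ℕ} (h : Feasible n c u) (hd : 0 < discount w u) (hi : i < n) :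
    threshold (allocPrice n law w c u i j)
        (ENNReal.ofReal (allocShare n w c u (n - (i + 1)) (i + 1) j)) =
      allocThreshold n law c u i j := by
  rw [allocPrice, allocThreshold]
  split_ifs with hs
  · have hm : i + 1 + (n - (i + 1)) = n := by omega
    have hS := discount_le hw h hm hs.1
    obtain ⟨h0, -, -⟩ := allocShare_mem_Icc hw h hm.le j
    rw [mul_comm, ENNReal.ofReal_mul (by linarith), mul_comm, ENNReal.ofReal_sub _ h0,
      ENNReal.ofReal_one]
    refine threshold_mul _ ?_
    rw [← ENNReal.ofReal_one, ENNReal.ofReal_lt_ofReal_iff one_pos]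
    linarith
  · exact threshold_top _

/-- Backward induction: once the later agents use the intended thresholds, the equilibrium share of
the current agent is the one built into her price, so she uses hers too. -/
lemma sum_weight_mul_finalProb {n : ℕ} {law : ℕ → MeasureTheory.Measure ℝ}
    (hreg : ∀ i, i < n → IsRegular (law i)) {w : ℕ → ℝ≥0} (hw : IsAvailability n w) {c : ℕ → ℕ}
    {u : ℕ} (h : Feasible n c u) (hd : 0 < discount w u) {p : ℕ → ℕ → ℝ≥0∞}
    (hp : ∀ i j, j ≤ i → i < n → p i j = allocPrice n law w c u i j) {m i j : ℕ}
    (hm : i + m = n) (hj : j ≤ i) :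
    ∑ l ∈ Finset.range (n + 1), (w l : ℝ≥0∞) * finalProb n law w p m i j l =
      ENNReal.ofReal (allocShare n w c u m i j) := by
  induction m generalizing i j with
  | zero =>
    simp only [finalProb, allocShare, mul_ite, mul_one, mul_zero, Finset.sum_ite_eq',
      Finset.mem_range]
    rw [if_pos (by omega), ENNReal.ofReal_coe_nnreal]
  | succ m ih =>
    have hi : i < n := by omega
    obtain rfl : m = n - (i + 1) := by omega
    have h1 := ih (i := i + 1) (j := j) (by omega) (by omega)
    have h2 := ih (i := i + 1) (j := j + 1) (by omega) (by omega)
    simp only [finalProb]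
    rw [h1, hp i j hj hi, threshold_allocPrice hw h hd hi]
    simp only [mul_add, mul_left_comm (w _ : ℝ≥0∞), Finset.sum_add_distrib, ← Finset.mul_sum]
    rw [h1, h2]
    by_cases hs : Served c u i j
    · obtain ⟨f0, f1⟩ := h.frac hi
      obtain ⟨a0, -, -⟩ := allocShare_mem_Icc hw h (show i + 1 + (n - (i + 1)) ≤ n by omega) j
      obtain ⟨b0, -, -⟩ := allocShare_mem_Icc hw h (show i + 1 + (n - (i + 1)) ≤ n by omega) (j + 1)
      have f1' := sub_nonneg.2 f1.le
      rw [allocShare, if_pos hs, buyProb_allocThreshold hreg h hi hs,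
        passProb_allocThreshold hreg h hi hs, ENNReal.ofReal_add (by positivity) (by positivity),
        ENNReal.ofReal_mul f1', ENNReal.ofReal_mul f0]
    · have := (hreg i hi).1
      have hadd := passProb_add_buyProb (law i) ⊤
      rw [buyProb_top, add_zero] at hadd
      rw [allocShare, if_neg hs, allocThreshold, if_neg hs, buyProb_top, hadd, one_mul, zero_mul,
        add_zero]

lemma eqThreshold_eq_allocThreshold {n : ℕ} {law : ℕ → MeasureTheory.Measure ℝ}
    (hreg : ∀ i, i < n → IsRegular (law i)) {w : ℕ → ℝ≥0} (hw : IsAvailability n w) {c : ℕ → ℕ}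
    {u : ℕ} (h : Feasible n c u) (hd : 0 < discount w u) {p : ℕ → ℕ → ℝ≥0∞}
    (hp : ∀ i j, j ≤ i → i < n → p i j = allocPrice n law w c u i j) {i j : ℕ}
    (hi : i < n) (hj : j ≤ i) :
    eqThreshold n law w p i j = allocThreshold n law c u i j := by
  simp only [eqThreshold, finalProbAfter]
  rw [sum_weight_mul_finalProb hreg hw h hd hp (by omega) (by omega), hp i j hj hi,
    threshold_allocPrice hw h hd hi]

/-- By Markov's inequality, units are left for each agent with probability at least `1 / 2`. -/
lemma half_le_sum_reachProb {n : ℕ} {law : ℕ → MeasureTheory.Measure ℝ}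
    (hreg : ∀ i, i < n → IsRegular (law i)) {c : ℕ → ℕ} {u : ℕ} (h : Feasible n c u)
    {T : ℕ → ℕ → ℝ≥0∞} (hT : ∀ i j, j ≤ i → i < n → T i j = allocThreshold n law c u i j) {i : ℕ}
    (hi : i < n) :
    2⁻¹ ≤ ∑ j ∈ Finset.range (i + 1) with j + 1 ≤ u, reachProb law T i j := by
  have hlaw : ∀ i, i < n → MeasureTheory.IsProbabilityMeasure (law i) := fun i hi => (hreg i hi).1
  have htotal := sum_reachProb hlaw T hi.le
  rw [← Finset.sum_filter_add_sum_filter_not _ (fun j => j + 1 ≤ u)] at htotal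
  set B := ∑ j ∈ Finset.range (i + 1) with ¬ j + 1 ≤ u, reachProb law T i j
  have hbuy : ∀ i' j, j ≤ i' → i' < n →
      buyProb (law i') (T i' j) ≤ ENNReal.ofReal (c i' / (4 * n)) := fun i' j hj hi' => by
    rw [hT i' j hj hi']
    by_cases hs : Served c u i' j
    · rw [buyProb_allocThreshold hreg h hi' hs]
    · rw [allocThreshold, if_neg hs, buyProb_top]; exact zero_le
  -- Markov: `u * B` is at most the expected number of earlier sales, hence at most the total
  -- allocated probability, which is at most `u / 2`.
  have hcount : (u : ℝ≥0∞) * B ≤ u * 2⁻¹ := by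
    calc (u : ℝ≥0∞) * B
        = ∑ j ∈ Finset.range (i + 1) with ¬ j + 1 ≤ u, reachProb law T i j * u := by
          rw [mul_comm, Finset.sum_mul]
      _ ≤ ∑ j ∈ Finset.range (i + 1) with ¬ j + 1 ≤ u, reachProb law T i j * j := by
          refine Finset.sum_le_sum fun j hj => mul_le_mul_right ?_ _
          have := (Finset.mem_filter.1 hj).2
          exact_mod_cast (show u ≤ j by omega)
      _ ≤ ∑ j ∈ Finset.range (i + 1), reachProb law T i j * j :=
          Finset.sum_le_sum_of_subset (Finset.filter_subset _ _)
      _ ≤ ∑ i' ∈ Finset.range i, ENNReal.ofReal (c i' / (4 * n)) := by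
          rw [sum_reachProb_mul_count hlaw T hi.le]
          refine Finset.sum_le_sum fun i' hi' => ?_
          have hi'n := (Finset.mem_range.1 hi').trans hi
          calc _ ≤ ∑ j ∈ Finset.range (i' + 1),
                  reachProb law T i' j * ENNReal.ofReal (c i' / (4 * n)) :=
                Finset.sum_le_sum fun j hj => mul_le_mul_right
                  (hbuy i' j (Nat.le_of_lt_succ (Finset.mem_range.1 hj)) hi'n) _
            _ = _ := by rw [← Finset.sum_mul, sum_reachProb hlaw T hi'n.le, one_mul]
      _ ≤ ∑ i' ∈ Finset.range n, ENNReal.ofReal (c i' / (4 * n)) :=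
          Finset.sum_le_sum_of_subset (Finset.range_mono hi.le)
      _ = ENNReal.ofReal (∑ i' ∈ Finset.range n, c i' / (4 * n)) :=
          (ENNReal.ofReal_sum_of_nonneg fun _ _ => by positivity).symm
      _ ≤ ENNReal.ofReal (u / 2) := ENNReal.ofReal_le_ofReal h.sum_frac_le
      _ = u * 2⁻¹ := by
          rw [div_eq_mul_inv, ENNReal.ofReal_mul (by positivity), ENNReal.ofReal_natCast,
            ENNReal.ofReal_inv_of_pos two_pos, ENNReal.ofReal_ofNat]
  have hu0 : (u : ℝ≥0∞) ≠ 0 := by exact_mod_cast (Nat.pos_iff_ne_zero.1 h.pos)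
  have hB : B ≤ 2⁻¹ := (ENNReal.mul_le_mul_iff_right hu0 (ENNReal.natCast_ne_top u)).1 hcount
  rw [← ENNReal.inv_two_add_inv_two] at htotal
  refine ENNReal.le_of_add_le_add_right (a := 2⁻¹) (by simp) ?_
  rw [← htotal]
  gcongr

/-- The revenue guarantee of the prices that implement a feasible allocation. -/
theorem le_revenue_of_eq_allocPrice {n : ℕ} {law : ℕ → MeasureTheory.Measure ℝ}
    (hreg : ∀ i, i < n → IsRegular (law i)) {w : ℕ → ℝ≥0} (hw : IsAvailability n w) {c : ℕ → ℕ}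
    {u : ℕ} (h : Feasible n c u) (hd : 0 < discount w u) {p : ℕ → ℕ → ℝ≥0∞}
    (hp : ∀ i j, j ≤ i → i < n → p i j = allocPrice n law w c u i j) :
    ENNReal.ofReal (discount w u * allocRevenue n law c / 4) ≤ revenue n law w p := by
  have hT : ∀ i j, j ≤ i → i < n → eqThreshold n law w p i j = allocThreshold n law c u i j :=
    fun i j hj hi => eqThreshold_eq_allocThreshold hreg hw h hd hp hi hj
  rw [revenue, saleRevenue, allocRevenue, Finset.mul_sum, Finset.sum_div]
  rw [ENNReal.ofReal_sum_of_nonneg]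
  swap
  · intro i hi
    rw [Finset.mem_range] at hi
    have := (hreg i hi).gridRevenue_nonneg (N := 4 * n) (by omega) (c i)
    positivity
  refine Finset.sum_le_sum fun i hi => ?_
  rw [Finset.mem_range] at hi
  have hg := (hreg i hi).gridRevenue_nonneg (N := 4 * n) (by omega) (c i)
  set g := gridRevenue (law i) (4 * n) (c i)
  have hpay : ∀ j, j ≤ i → j + 1 ≤ u → ENNReal.ofReal (discount w u / 2 * g) ≤
      p i j * buyProb (law i) (eqThreshold n law w p i j) := by
    intro j hj hju
    rw [hT i j hj hi, hp i j hj hi]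
    rcases Nat.eq_zero_or_pos (c i) with hc | hc
    · simp [g, hc]
    have hs : Served c u i j := ⟨hju, hc⟩
    rw [buyProb_allocThreshold hreg h hi hs, allocPrice, if_pos hs]
    have hS := discount_le hw h (show i + 1 + (n - (i + 1)) = n by omega) hju
    have hq := grid_mem_Ioo (N := 4 * n) hc (h.lt_grid i hi)
    have hQ := ((hreg i hi).quantile_pos hq.1 hq.2).le
    push_cast at hQ
    rw [← ENNReal.ofReal_mul (mul_nonneg hQ (by linarith))]
    refine ENNReal.ofReal_le_ofReal ?_
    calc discount w u / 2 * g ≤ (1 - allocShare n w c u (n - (i + 1)) (i + 1) j) * g :=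
          mul_le_mul_of_nonneg_right hS hg
      _ = _ := by simp only [g, gridRevenue]; push_cast; ring
  -- The `4` is a factor `2` from the chance that units remain times a factor `2` from the bound on
  -- `1 - share`.
  calc ENNReal.ofReal (discount w u * g / 4)
      = 2⁻¹ * ENNReal.ofReal (discount w u / 2 * g) := by
        rw [show discount w u * g / 4 = 2⁻¹ * (discount w u / 2 * g) by ring,
          ENNReal.ofReal_mul (by positivity), ENNReal.ofReal_inv_of_pos two_pos,
          ENNReal.ofReal_ofNat]
    _ ≤ (∑ j ∈ Finset.range (i + 1) with j + 1 ≤ u, reachProb law (eqThreshold n law w p) i j) *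
          ENNReal.ofReal (discount w u / 2 * g) :=
        mul_le_mul_left (half_le_sum_reachProb hreg h hT hi) _
    _ ≤ ∑ j ∈ Finset.range (i + 1) with j + 1 ≤ u, reachProb law (eqThreshold n law w p) i j *
          (p i j * buyProb (law i) (eqThreshold n law w p i j)) := by
        rw [Finset.sum_mul]
        refine Finset.sum_le_sum fun j hj => mul_le_mul_right ?_ _
        rw [Finset.mem_filter, Finset.mem_range] at hj
        exact hpay j (by omega) hj.2
    _ ≤ _ := Finset.sum_le_sum_of_subset (Finset.filter_subset _ _)

/-! ### Reasoning about programs -/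

/-- Program `A`, started in `s`, halts within `T` steps in a state that satisfies `Q`. -/
def Ensures (O : Oracle) (A : Program) (s : State) (T : ℕ) (Q : State → Prop) : Prop :=
  ∃ s' t, Exec O A s s' t ∧ t ≤ T ∧ Q s'

lemma update₃_of_ne {α : Type} (f : ℕ → ℕ → ℕ → α) {a a' : ℕ} (h : a' ≠ a) (i j : ℕ) (x : α) :
    update₃ f a i j x a' = f a' := by
  funext i' j'
  simp [update₃, h]

lemma update₃_self {α : Type} (f : ℕ → ℕ → ℕ → α) (a i j : ℕ) (x : α) :
    update₃ f a i j x a = Function.update (f a) i (Function.update (f a i) j x) := by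
  funext i' j'
  by_cases hi : i' = i
  · subst hi; by_cases hj : j' = j <;> simp [update₃, hj]
  · simp [update₃, hi]

lemma update₂_eq {α : Type} (f : ℕ → ℕ → α) (i j : ℕ) (x : α) :
    update₂ f i j x = Function.update f i (Function.update (f i) j x) := by
  funext i' j'
  by_cases hi : i' = i
  · subst hi; by_cases hj : j' = j <;> simp [update₂, hj]
  · simp [update₂, hi]

namespace Ensures

variable {O : Oracle} {A B : Program} {s : State} {T T' : ℕ} {Q Q' : State → Prop}

lemma mono (h : Ensures O A s T Q) (hT : T ≤ T') (hQ : ∀ s', Q s' → Q' s') :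
    Ensures O A s T' Q' := by
  obtain ⟨s', t, he, ht, hq⟩ := h
  exact ⟨s', t, he, ht.trans hT, hQ s' hq⟩

lemma skip (h : Q s) : Ensures O .skip s 1 Q := ⟨s, 1, .skip s, le_rfl, h⟩

lemma setNat {a : ℕ} {i j e : NatExpr}
    (h : Q { s with nat := update₃ s.nat a (i.eval s) (j.eval s) (e.eval s) }) :
    Ensures O (.setNat a i j e) s (i.cost + j.cost + e.cost + 1) Q :=
  ⟨_, _, .setNat s a i j e, le_rfl, h⟩

lemma setReal {a : ℕ} {i j : NatExpr} {x : RealExpr}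
    (h : Q { s with real := update₃ s.real a (i.eval s) (j.eval s) (x.eval O s) }) :
    Ensures O (.setReal a i j x) s (i.cost + j.cost + x.cost + 1) Q :=
  ⟨_, _, .setReal s a i j x, le_rfl, h⟩

lemma emit {i j : NatExpr} {x : RealExpr}
    (h : Q { s with out := update₂ s.out (i.eval s) (j.eval s) (ENNReal.ofReal (x.eval O s)) }) :
    Ensures O (.emit i j x) s (i.cost + j.cost + x.cost + 1) Q :=
  ⟨_, _, .emit s i j x, le_rfl, h⟩

lemma emitTop {i j : NatExpr}
    (h : Q { s with out := update₂ s.out (i.eval s) (j.eval s) ⊤ }) :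
    Ensures O (.emitTop i j) s (i.cost + j.cost + 1) Q :=
  ⟨_, _, .emitTop s i j, le_rfl, h⟩

lemma seq (hA : Ensures O A s T (fun s' => Ensures O B s' T' Q)) :
    Ensures O (.seq A B) s (T + T') Q := by
  obtain ⟨s', t, he, ht, s'', t', he', ht', hq⟩ := hA
  exact ⟨s'', t + t', .seq he he', add_le_add ht ht', hq⟩

lemma ite {b : Test} (hA : b.Holds O s → Ensures O A s T Q)
    (hB : ¬ b.Holds O s → Ensures O B s T' Q) :
    Ensures O (.ite b A B) s (b.cost + max T T') Q := by
  by_cases hb : b.Holds O s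
  · obtain ⟨s', t, he, ht, hq⟩ := hA hb
    exact ⟨s', _, .iteTrue hb he, by omega, hq⟩
  · obtain ⟨s', t, he, ht, hq⟩ := hB hb
    exact ⟨s', _, .iteFalse hb he, by omega, hq⟩

end Ensures

/-- The scalar variable stored at the origin of an array. -/
def natVar (a : ℕ) : NatExpr := .get a (.const 0) (.const 0)

/-- `for a = 0, …, bound - 1 do A`. -/
def forLoop (a : ℕ) (bound : NatExpr) (A : Program) : Program :=
  .seq (.setNat a (.const 0) (.const 0) (.const 0))
    (.while (.natLe (.add (natVar a) (.const 1)) bound)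
      (.seq A (.setNat a (.const 0) (.const 0) (.add (natVar a) (.const 1)))))

/-- The state with the scalar natural-number variable `a` set to `k`. -/
def State.setVar (s : State) (a k : ℕ) : State := { s with nat := update₃ s.nat a 0 0 k }

lemma State.setVar_nat_of_ne (s : State) {a a' : ℕ} (h : a' ≠ a) (k : ℕ) :
    (s.setVar a k).nat a' = s.nat a' := update₃_of_ne _ h _ _ _

/-- The body must preserve the counter, and the invariant is required after its increment. Per
round, `bound.cost + 6` steps go to the test and `8` to the increment. -/
lemma Ensures.forLoop {O : Oracle} {a m T : ℕ} {bound : NatExpr} {A : Program} {s : State}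
    (Inv : ℕ → State → Prop) (h0 : Inv 0 (s.setVar a 0))
    (hbound : ∀ k s, Inv k s → bound.eval s = m)
    (hstep : ∀ k < m, ∀ s, Inv k s → s.nat a 0 0 = k →
      Ensures O A s T (fun s' => s'.nat a 0 0 = k ∧ Inv (k + 1) (s'.setVar a (k + 1)))) :
    Ensures O (forLoop a bound A) s ((m + 1) * (T + bound.cost + 14)) (Inv m) := by
  have hloop : ∀ r k, k + r = m → ∀ s, Inv k s → s.nat a 0 0 = k →
      Ensures O (.while (.natLe (.add (natVar a) (.const 1)) bound)
        (.seq A (.setNat a (.const 0) (.const 0) (.add (natVar a) (.const 1))))) s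
        (r * (T + bound.cost + 14) + bound.cost + 6) (Inv m) := by
    intro r
    induction r with
    | zero =>
      rintro k rfl s hs hk
      refine ⟨s, _, .whileFalse ?_, ?_, hs⟩
      · simp [Test.Holds, NatExpr.eval, natVar, hk, hbound _ s hs]
      · simp only [Test.cost, NatExpr.cost, natVar]; omega
    | succ r ih =>
      intro k hkr s hs hk
      obtain ⟨s₁, t₁, he₁, ht₁, hk₁, hinv₁⟩ := hstep k (by omega) s hs hk
      obtain ⟨s₂, t₂, he₂, ht₂, hq⟩ := ih (k + 1) (by omega) (s₁.setVar a (k + 1)) hinv₁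
        (by simp [State.setVar, update₃])
      refine ⟨s₂, _, .whileTrue (t' := t₂) ?_ (.seq he₁ (.setNat s₁ a _ _ _)) ?_, ?_, hq⟩
      · simp only [Test.Holds, NatExpr.eval, natVar, hk, hbound _ s hs]; omega
      · simpa [NatExpr.eval, natVar, hk₁, State.setVar] using he₂
      · simp only [Test.cost, NatExpr.cost, natVar, Nat.add_mul]; omega
  refine (Ensures.seq (T := 4) (T' := m * (T + bound.cost + 14) + bound.cost + 6)
    (Ensures.setNat ?_)).mono ?_ fun _ h => h
  · exact hloop m 0 (by omega) _ (by simpa [NatExpr.eval, State.setVar] using h0)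
      (by simp [NatExpr.eval, update₃])
  · rw [Nat.add_mul]; omega

/-! ### The program -/

/-- The revenue of the agent in variable `4` when her selling probability is `e / (4 n)`. -/
def gridExpr (e : NatExpr) : RealExpr :=
  .mul (.div (.ofNat e) (.mul (.const 4) (.ofNat (natVar 0))))
    (.quantile (natVar 4) (.sub (.const 1) (.div (.ofNat e) (.mul (.const 4) (.ofNat (natVar 0))))))

/-- The marginal gain of the agent in variable `4`, for the allocation in row `1` of array `6`. -/
def marginalExpr : RealExpr :=
  .sub (gridExpr (.add (.get 6 (natVar 1) (natVar 4)) (.const 1)))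
    (gridExpr (.get 6 (natVar 1) (natVar 4)))

/-- Memory map. Natural numbers: `0` holds `n`, `1` the row `y = u - 1`, `2` the budget of greedy
steps, `3` the step counter, `4` an agent counter, `5` the best agent, `6` the allocations by rows,
`7` the selected row, `8` the number of sold units. Reals: `0` the row revenues, `1` the best
marginal, `2` the best score, `3` the table of shares. -/
def realVar (a : ℕ) : RealExpr := .get a (.const 0) (.const 0)

/-- Find the agent with the largest positive marginal gain. -/
def argmaxProgram : Program :=
  forLoop 4 (natVar 0)
    (.ite (.realLe marginalExpr (realVar 1)) .skip
      (.seq (.setReal 1 (.const 0) (.const 0) marginalExpr)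
        (.setNat 5 (.const 0) (.const 0) (natVar 4))))

/-- One greedy step. -/
def greedyStep : Program :=
  .seq (.setReal 1 (.const 0) (.const 0) (.const 0))
    (.seq argmaxProgram
      (.ite (.realLe (realVar 1) (.const 0)) .skip
        (.seq
          (.setNat 6 (natVar 1) (natVar 5) (.add (.get 6 (natVar 1) (natVar 5)) (.const 1)))
          (.setReal 0 (natVar 1) (.const 0)
            (.add (.get 0 (natVar 1) (.const 0)) (realVar 1))))))

lemma gridExpr_eval (law : ℕ → MeasureTheory.Measure ℝ) (w : ℕ → ℝ≥0) (s : State) (e : NatExpr) :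
    (gridExpr e).eval (oracle law w) s =
      gridRevenue (law (s.nat 4 0 0)) (4 * s.nat 0 0 0) (e.eval s) := by
  simp [gridExpr, RealExpr.eval, NatExpr.eval, natVar, oracle, gridRevenue]

lemma marginalExpr_eval (law : ℕ → MeasureTheory.Measure ℝ) (w : ℕ → ℝ≥0) (s : State) :
    marginalExpr.eval (oracle law w) s =
      marginal (s.nat 0 0 0) law (s.nat 6 (s.nat 1 0 0)) (s.nat 4 0 0) := by
  simp [marginalExpr, RealExpr.eval, gridExpr_eval, marginal, NatExpr.eval, natVar]

/-- `bi` has the largest positive marginal gain, or no agent has one and `best = 0`. -/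
def IsBest (n : ℕ) (law : ℕ → MeasureTheory.Measure ℝ) (c : ℕ → ℕ) (k : ℕ) (best : ℝ)
    (bi : ℕ) : Prop :=
  0 ≤ best ∧ (∀ i < k, marginal n law c i ≤ best) ∧ (0 < best → bi < k ∧ best = marginal n law c bi)

/-- Since the running maximum starts at `0`, a final value `0` signals that no marginal is positive
and greedy must stay. -/
lemma argmaxProgram_ensures {law : ℕ → MeasureTheory.Measure ℝ} {w : ℕ → ℝ≥0} {s : State}
    (h0 : s.real 1 0 0 = 0) :
    Ensures (oracle law w) argmaxProgram s ((s.nat 0 0 0 + 1) * 210) (fun s' =>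
      (∀ a, a ≠ 4 → a ≠ 5 → s'.nat a = s.nat a) ∧ (∀ a, a ≠ 1 → s'.real a = s.real a) ∧
      IsBest (s.nat 0 0 0) law (s.nat 6 (s.nat 1 0 0)) (s.nat 0 0 0) (s'.real 1 0 0)
        (s'.nat 5 0 0)) := by
  refine (Ensures.forLoop (m := s.nat 0 0 0) (T := 190) (fun k s' =>
      (∀ a, a ≠ 4 → a ≠ 5 → s'.nat a = s.nat a) ∧ (∀ a, a ≠ 1 → s'.real a = s.real a) ∧
      IsBest (s.nat 0 0 0) law (s.nat 6 (s.nat 1 0 0)) k (s'.real 1 0 0) (s'.nat 5 0 0))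
      ?_ ?_ ?_).mono ?_ fun _ h => h
  · refine ⟨fun a h4 _ => ?_, fun a _ => rfl, ?_⟩
    · rw [State.setVar_nat_of_ne _ h4]
    · simp [State.setVar, h0, IsBest]
  · rintro k s' ⟨hn, -⟩
    simp [NatExpr.eval, natVar, hn]
  · rintro k hk s' ⟨hn, hr, hbest⟩ h4
    have heval := marginalExpr_eval law w s'
    rw [h4, hn 0 (by norm_num) (by norm_num), hn 6 (by norm_num) (by norm_num),
      hn 1 (by norm_num) (by norm_num)] at heval
    set c := s.nat 6 (s.nat 1 0 0)
    set n := s.nat 0 0 0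
    obtain ⟨hb0, hb1, hb2⟩ := hbest
    refine (Ensures.ite (T := 1) (T' := 100) (fun hle => Ensures.skip ?_) (fun hlt =>
      (Ensures.seq (Ensures.setReal (Ensures.setNat ?_))).mono ?_ fun _ h => h)).mono ?_
      fun _ h => h
    · simp only [Test.Holds, heval, realVar, RealExpr.eval, NatExpr.eval] at hle
      refine ⟨h4, fun a h4 h5 => ?_, hr, hb0, fun i hi => ?_, fun hpos => ?_⟩
      · rw [State.setVar_nat_of_ne _ h4]; exact hn a h4 h5
      · rcases (Nat.le_of_lt_succ hi).lt_or_eq with hi | rfl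
        · exact hb1 i hi
        · exact hle
      · obtain ⟨h1, h2⟩ := hb2 hpos
        rw [State.setVar_nat_of_ne _ (by norm_num)]
        exact ⟨h1.trans (Nat.lt_succ_self k), h2⟩
    · simp only [Test.Holds, heval, realVar, RealExpr.eval, NatExpr.eval, not_le] at hlt
      simp only [State.setVar, NatExpr.eval, natVar, heval, h4]
      refine ⟨?_, fun a h4 h5 => ?_, fun a h1 => ?_, ?_⟩
      · rw [update₃_of_ne _ (by norm_num)]; exact h4
      · rw [update₃_of_ne _ h4, update₃_of_ne _ h5]; exact hn a h4 h5
      · rw [update₃_of_ne _ h1]; exact hr a h1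
      · rw [update₃_self, update₃_of_ne _ (by norm_num), update₃_self]
        simp only [Function.update_self]
        refine ⟨hb0.trans hlt.le, fun i hi => ?_, fun _ => ⟨Nat.lt_succ_self k, rfl⟩⟩
        rcases (Nat.le_of_lt_succ hi).lt_or_eq with hi | rfl
        · exact (hb1 i hi).trans hlt.le
        · exact le_rfl
    · simp [NatExpr.cost, RealExpr.cost, natVar, marginalExpr, gridExpr]
    · simp [NatExpr.cost, RealExpr.cost, Test.cost, natVar, marginalExpr, gridExpr, realVar]
  · simp [NatExpr.cost, natVar]

/-- Row `y` of the memory holds a greedy allocation of at most `b` steps and its revenue. -/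
def RowGreedy (n : ℕ) (law : ℕ → MeasureTheory.Measure ℝ) (y b : ℕ) (s : State) : Prop :=
  GreedyAlloc n law (s.nat 6 y) b ∧ s.real 0 y 0 = allocRevenue n law (s.nat 6 y)

/-- Outside the scratch variables, `s'` differs from `s` only in row `y`. -/
def SameOutsideRow (y : ℕ) (s s' : State) : Prop :=
  (∀ a, a ≠ 3 → a ≠ 4 → a ≠ 5 → a ≠ 6 → s'.nat a = s.nat a) ∧
  (∀ y', y' ≠ y → s'.nat 6 y' = s.nat 6 y') ∧
  (∀ a, a ≠ 0 → a ≠ 1 → s'.real a = s.real a) ∧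
  (∀ y', y' ≠ y → s'.real 0 y' = s.real 0 y')

lemma greedyStep_ensures {n : ℕ} {law : ℕ → MeasureTheory.Measure ℝ} {w : ℕ → ℝ≥0}
    (hreg : ∀ i, i < n → IsRegular (law i)) {s : State} {y b : ℕ}
    (hn : s.nat 0 0 0 = n) (hy : s.nat 1 0 0 = y) (hrow : RowGreedy n law y b s) :
    Ensures (oracle law w) greedyStep s ((n + 1) * 310) (fun s' =>
      s'.nat 3 = s.nat 3 ∧ SameOutsideRow y s s' ∧ RowGreedy n law y (b + 1) s') := by
  obtain ⟨hg, hV⟩ := hrow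
  refine (Ensures.seq (Ensures.setReal (Ensures.seq (T' := 90) ((argmaxProgram_ensures
    (by simp [NatExpr.eval, RealExpr.eval, update₃])).mono le_rfl ?_)))).mono ?_
    fun _ h => h
  · rintro s₁ ⟨hnat, hreal, hbest⟩
    simp only [hn, hy, RealExpr.eval, NatExpr.eval] at hnat hreal hbest
    have hreal' : ∀ a, a ≠ 1 → s₁.real a = s.real a := fun a ha => by
      rw [hreal a ha, update₃_of_ne _ ha]
    have hy₁ : s₁.nat 1 0 0 = y := by rw [hnat 1 (by norm_num) (by norm_num), hy]
    have h6 := hnat 6 (by norm_num) (by norm_num)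
    have h0 := hreal' 0 (by norm_num)
    obtain ⟨hb0, hb1, hb2⟩ := hbest
    refine (Ensures.ite (T := 1) (T' := 50) (fun hle => Ensures.skip ?_) (fun hlt =>
      (Ensures.seq (Ensures.setNat (Ensures.setReal ?_))).mono ?_ fun _ h => h)).mono ?_
      fun _ h => h
    · simp only [Test.Holds, realVar, RealExpr.eval, NatExpr.eval, Rat.cast_zero] at hle
      refine ⟨hnat 3 (by norm_num) (by norm_num), ⟨fun a _ h4 h5 _ => hnat a h4 h5,
        fun y' _ => by rw [h6], fun a _ h1 => hreal' a h1, fun y' _ => by rw [h0]⟩, ?_, ?_⟩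
      · rw [h6]
        exact hg.stay hreg fun i hi => (hb1 i hi).trans hle
      · rw [h6, h0, hV]
    · simp only [Test.Holds, realVar, RealExpr.eval, NatExpr.eval, not_le, Rat.cast_zero] at hlt
      obtain ⟨hbi, hbm⟩ := hb2 hlt
      simp only [NatExpr.eval, RealExpr.eval, natVar, realVar, hy₁]
      rw [update₃_of_ne _ (show (1 : ℕ) ≠ 6 by norm_num), hy₁]
      simp only [SameOutsideRow, RowGreedy]
      refine ⟨?_, ⟨fun a _ h4 h5 h6 => ?_, fun y' hy' => ?_, fun a h0 h1 => ?_, fun y' hy' => ?_⟩,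
        ?_, ?_⟩
      · rw [update₃_of_ne _ (by norm_num)]; exact hnat 3 (by norm_num) (by norm_num)
      · rw [update₃_of_ne _ h6]; exact hnat a h4 h5
      · rw [update₃_self, Function.update_of_ne hy', h6]
      · rw [update₃_of_ne _ h0]; exact hreal' a h1
      · rw [update₃_self, Function.update_of_ne hy', h0]
      · rw [update₃_self, Function.update_self, h6]
        exact hg.step hreg hbi (hbm ▸ hlt) fun i hi => (hb1 i hi).trans hbm.le
      · rw [update₃_self, update₃_self, Function.update_self, Function.update_self,
          Function.update_self, h6, h0, allocRevenue_update law _ hbi, hV, hbm]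
    · simp [NatExpr.cost, RealExpr.cost, natVar, realVar]
    · simp [NatExpr.cost, RealExpr.cost, Test.cost, realVar]
  · simp [NatExpr.cost, RealExpr.cost, hn]
    omega

/-- The greedy allocation in row `1`. -/
def greedyProgram : Program := forLoop 3 (natVar 2) greedyStep

lemma greedyProgram_ensures {n : ℕ} {law : ℕ → MeasureTheory.Measure ℝ} {w : ℕ → ℝ≥0}
    (hreg : ∀ i, i < n → IsRegular (law i)) {s : State} {y B : ℕ}
    (hn : s.nat 0 0 0 = n) (hy : s.nat 1 0 0 = y) (hB : s.nat 2 0 0 = B)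
    (hc : s.nat 6 y = fun _ => 0) (hV : s.real 0 y 0 = 0) :
    Ensures (oracle law w) greedyProgram s ((B + 1) * ((n + 1) * 330)) (fun s' =>
      SameOutsideRow y s s' ∧ RowGreedy n law y B s') := by
  refine (Ensures.forLoop (m := B) (T := (n + 1) * 310) (fun k s' =>
      SameOutsideRow y s s' ∧ RowGreedy n law y k s') ⟨⟨?_, ?_, ?_, ?_⟩, ?_, ?_⟩ ?_ ?_).mono ?_
      fun _ h => h
  · intro a h3 _ _ _
    rw [State.setVar_nat_of_ne _ h3]
  · intro y' _
    rw [State.setVar_nat_of_ne _ (by norm_num)]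
  · exact fun _ _ _ => rfl
  · exact fun _ _ => rfl
  · rw [State.setVar_nat_of_ne _ (by norm_num), hc]
    exact greedyAlloc_zero hreg
  · rw [State.setVar_nat_of_ne _ (by norm_num), hc]
    simp [allocRevenue, State.setVar, hV]
  · rintro k s' ⟨⟨h, -⟩, -⟩
    simp [NatExpr.eval, natVar, h, hB]
  · rintro k - s₁ ⟨⟨h1, h2, h3, h4⟩, hrow⟩ hk
    refine (greedyStep_ensures hreg (by simp [h1, hn]) (by simp [h1, hy]) hrow).mono le_rfl ?_
    rintro s₂ ⟨h3', ⟨g1, g2, g3, g4⟩, hrow'⟩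
    refine ⟨by rw [h3', hk], ⟨fun a a3 a4 a5 a6 => ?_, fun y' hy' => ?_, fun a a0 a1 => ?_,
      fun y' hy' => ?_⟩, ?_⟩
    · rw [State.setVar_nat_of_ne _ a3, g1 a a3 a4 a5 a6, h1 a a3 a4 a5 a6]
    · rw [State.setVar_nat_of_ne _ (by norm_num), g2 y' hy', h2 y' hy']
    · change s₂.real a = _; rw [g3 a a0 a1, h3 a a0 a1]
    · change s₂.real 0 y' = _; rw [g4 y' hy', h4 y' hy']
    · rw [RowGreedy, State.setVar_nat_of_ne _ (by norm_num)]
      exact hrow'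
  · refine Nat.mul_le_mul_left _ ?_
    simp only [NatExpr.cost, natVar]; omega

/-- The guarantee, up to a constant, for `u = y + 1` units, where `y` is in variable `1`. -/
def scoreExpr : RealExpr :=
  .mul (.sub (.const 1) (.weight (.sub (.add (natVar 1) (.const 1))
    (.sub (.const 2) (.add (natVar 1) (.const 1))))))
    (.get 0 (natVar 1) (.const 0))

/-- Compute the greedy allocations for all numbers of units and select the one of best score. -/
def searchProgram : Program :=
  forLoop 1 (natVar 0)
    (.seq (.setNat 2 (.const 0) (.const 0) (.add (natVar 2) (.add (natVar 0) (natVar 0))))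
      (.seq greedyProgram
        (.ite (.realLe scoreExpr (realVar 2)) .skip
          (.seq (.setReal 2 (.const 0) (.const 0) scoreExpr)
            (.setNat 7 (.const 0) (.const 0) (natVar 1))))))

lemma scoreExpr_eval (law : ℕ → MeasureTheory.Measure ℝ) (w : ℕ → ℝ≥0) (s : State) :
    scoreExpr.eval (oracle law w) s =
      discount w (s.nat 1 0 0 + 1) * s.real 0 (s.nat 1 0 0) 0 := by
  simp [scoreExpr, RealExpr.eval, NatExpr.eval, natVar, oracle, discount]

/-- The state of the search after the first `k` numbers of units. -/
structure SearchInv (n : ℕ) (law : ℕ → MeasureTheory.Measure ℝ) (w : ℕ → ℝ≥0) (k : ℕ)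
    (s : State) : Prop where
  size : s.nat 0 0 0 = n
  budget : s.nat 2 0 0 = 2 * n * k
  choice_lt : s.nat 7 0 0 < n
  row : ∀ y < k, RowGreedy n law y (2 * n * (y + 1)) s
  fresh : ∀ y, k ≤ y → s.nat 6 y = (fun _ => 0) ∧ s.real 0 y 0 = 0
  score_nonneg : 0 ≤ s.real 2 0 0
  score_le : ∀ y < k, discount w (y + 1) * allocRevenue n law (s.nat 6 y) ≤ s.real 2 0 0
  score_eq : 0 < s.real 2 0 0 → s.nat 7 0 0 < k ∧
    s.real 2 0 0 = discount w (s.nat 7 0 0 + 1) * allocRevenue n law (s.nat 6 (s.nat 7 0 0))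

/-- The invariant does not read the row counter in variable `1`, so it survives the counter's
updates. -/
lemma SearchInv.congr {n : ℕ} {law : ℕ → MeasureTheory.Measure ℝ} {w : ℕ → ℝ≥0} {k : ℕ}
    {s s' : State} (h : SearchInv n law w k s) (hnat : ∀ a, a ≠ 1 → s'.nat a = s.nat a)
    (hreal : s'.real = s.real) : SearchInv n law w k s' := by
  obtain ⟨h1, h2, h3, h4, h5, h6, h7, h8⟩ := h
  simp only [RowGreedy] at h4
  constructor <;> simp only [RowGreedy, hreal, hnat 0 (by norm_num), hnat 2 (by norm_num),
    hnat 6 (by norm_num), hnat 7 (by norm_num)] <;> assumption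

lemma searchProgram_ensures {n : ℕ} {law : ℕ → MeasureTheory.Measure ℝ} {w : ℕ → ℝ≥0}
    (hreg : ∀ i, i < n → IsRegular (law i)) (hn : 1 ≤ n) :
    Ensures (oracle law w) searchProgram (State.init n)
      ((n + 1) * ((2 * n * n + 1) * ((n + 1) * 330) + 110)) (SearchInv n law w n) := by
  refine (Ensures.forLoop (m := n) (T := (2 * n * n + 1) * ((n + 1) * 330) + 90)
    (SearchInv n law w) ?_ ?_ ?_).mono ?_ fun _ h => h
  · refine SearchInv.congr (s := State.init n) ?_ (fun a ha => State.setVar_nat_of_ne _ ha 0) rfl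
    constructor <;> simp [State.init]
    omega
  · rintro k s h
    simp [NatExpr.eval, natVar, h.size]
  · rintro k hk s h hy
    -- There is no multiplication of natural numbers: the budget `2 n u` is kept by adding `2 n` for
    -- each new row.
    have hB : ((NatExpr.add (natVar 2) (.add (natVar 0) (natVar 0)))).eval s =
        2 * n * (k + 1) := by
      simp only [NatExpr.eval, natVar, h.size, h.budget]; ring
    simp only [NatExpr.eval] at hB
    refine (Ensures.seq (Ensures.setNat (Ensures.seq (T' := 70) ((greedyProgram_ensures (n := n)
      (y := k) (B := 2 * n * (k + 1)) hreg ?_ ?_ ?_ ?_ ?_).mono le_rfl ?_)))).mono ?_ fun _ h => h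
    · simp only; rw [update₃_of_ne _ (by norm_num), h.size]
    · simp only; rw [update₃_of_ne _ (by norm_num), hy]
    · simp only [hB, NatExpr.eval]; simp [update₃]
    · simp only; rw [update₃_of_ne _ (by norm_num), (h.fresh k le_rfl).1]
    · exact (h.fresh k le_rfl).2
    · simp only [hB, NatExpr.eval]
      rintro s₁ ⟨⟨g1, g2, g3, g4⟩, hrow⟩
      simp only at g1 g2 g3 g4
      rw [update₃_of_ne _ (show 6 ≠ 2 by norm_num)] at g2
      have n0 := g1 0 (by norm_num) (by norm_num) (by norm_num) (by norm_num)
      have n1 := g1 1 (by norm_num) (by norm_num) (by norm_num) (by norm_num)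
      have n2 := g1 2 (by norm_num) (by norm_num) (by norm_num) (by norm_num)
      have n7 := g1 7 (by norm_num) (by norm_num) (by norm_num) (by norm_num)
      rw [update₃_of_ne _ (by norm_num)] at n0 n1 n7
      have n2' : s₁.nat 2 0 0 = 2 * n * (k + 1) := by rw [n2]; simp [update₃]
      have r2 := g3 2 (by norm_num) (by norm_num)
      have hscore : scoreExpr.eval (oracle law w) s₁ =
          discount w (k + 1) * allocRevenue n law (s₁.nat 6 k) := by
        rw [scoreExpr_eval, n1, hy, hrow.2]
      have hrows : ∀ y < k + 1, RowGreedy n law y (2 * n * (y + 1)) s₁ := fun y hyk => by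
        rcases (Nat.le_of_lt_succ hyk).lt_or_eq with hlt | rfl
        · rw [RowGreedy, g2 y hlt.ne, g4 y hlt.ne]; exact h.row y hlt
        · exact hrow
      have hfresh : ∀ y, k + 1 ≤ y → s₁.nat 6 y = (fun _ => 0) ∧ s₁.real 0 y 0 = 0 :=
        fun y hyk => by
          rw [g2 y (by omega), g4 y (by omega)]; exact h.fresh y (by omega)
      refine (Ensures.ite (T := 1) (T' := 40) (fun hle => Ensures.skip ?_) (fun hlt =>
        (Ensures.seq (Ensures.setReal (Ensures.setNat ?_))).mono ?_ fun _ h => h)).mono ?_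
        fun _ h => h
      · simp only [Test.Holds, hscore, realVar, RealExpr.eval, NatExpr.eval] at hle
        refine ⟨by rw [n1, hy], SearchInv.congr (s := s₁) ?_
          (fun a ha => State.setVar_nat_of_ne _ ha _) rfl⟩
        refine ⟨by rw [n0, h.size], n2', by rw [n7]; exact h.choice_lt, hrows, hfresh,
          by rw [r2]; exact h.score_nonneg, fun y hyk => ?_, fun hpos => ?_⟩
        · rcases (Nat.le_of_lt_succ hyk).lt_or_eq with hlt | rfl
          · rw [g2 y hlt.ne, r2]; exact h.score_le y hlt
          · exact hle
        · rw [r2] at hpos ⊢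
          obtain ⟨e1, e2⟩ := h.score_eq hpos
          rw [n7, g2 _ e1.ne]
          exact ⟨e1.trans (Nat.lt_succ_self k), e2⟩
      · simp only [Test.Holds, hscore, realVar, RealExpr.eval, NatExpr.eval, not_le] at hlt
        simp only [hscore, NatExpr.eval, natVar, n1, hy]
        refine ⟨by rw [update₃_of_ne _ (by norm_num), n1, hy], SearchInv.congr (s :=
          ⟨update₃ s₁.nat 7 0 0 k, update₃ s₁.real 2 0 0
            (discount w (k + 1) * allocRevenue n law (s₁.nat 6 k)), s₁.out⟩) ?_
          (fun a ha => State.setVar_nat_of_ne _ ha _) rfl⟩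
        have m7 : update₃ s₁.nat 7 0 0 k 7 0 0 = k := by simp [update₃]
        have m2 : update₃ s₁.real 2 0 0
            (discount w (k + 1) * allocRevenue n law (s₁.nat 6 k)) 2 0 0 =
            discount w (k + 1) * allocRevenue n law (s₁.nat 6 k) := by simp [update₃]
        rw [r2] at hlt
        constructor <;> simp only [RowGreedy, m7, m2]
        · rw [update₃_of_ne _ (by norm_num), n0, h.size]
        · rw [update₃_of_ne _ (by norm_num), n2']
        · exact hk
        · rw [update₃_of_ne _ (by norm_num), update₃_of_ne _ (by norm_num)]; exact hrows
        · rw [update₃_of_ne _ (by norm_num), update₃_of_ne _ (by norm_num)]; exact hfresh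
        · exact h.score_nonneg.trans hlt.le
        · rw [update₃_of_ne _ (by norm_num)]
          intro y hyk
          rcases (Nat.le_of_lt_succ hyk).lt_or_eq with hlt' | rfl
          · rw [g2 y hlt'.ne]; exact (h.score_le y hlt').trans hlt.le
          · exact le_rfl
        · rw [update₃_of_ne _ (by norm_num)]
          exact fun _ => ⟨Nat.lt_succ_self k, rfl⟩
      · simp [NatExpr.cost, RealExpr.cost, scoreExpr, natVar]
      · simp [NatExpr.cost, RealExpr.cost, Test.cost, scoreExpr, natVar, realVar]
    · have : (2 * n * (k + 1) + 1) * ((n + 1) * 330) ≤ (2 * n * n + 1) * ((n + 1) * 330) := by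
        gcongr
        exact hk
      simp only [NatExpr.cost, natVar]
      omega
  · simp only [NatExpr.cost, natVar]
    exact Nat.mul_le_mul_left _ (by omega)

/-! ### Output of the price matrix -/

/-- The current agent: the loop variable `4` counts the agents from the last one. -/
def agentExpr : NatExpr := .sub (natVar 0) (.add (natVar 4) (.const 1))

/-- The number of grid steps of the current agent in the selected allocation. -/
def stepsExpr : NatExpr := .get 6 (natVar 7) agentExpr

def fracExpr : RealExpr := .div (.ofNat stepsExpr) (.mul (.const 4) (.ofNat (natVar 0)))

/-- The share of the next agent when `j` agents have bought. -/
def shareExpr (j : NatExpr) : RealExpr := .get 3 (.add agentExpr (.const 1)) j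

def serveProgram : Program :=
  .seq (.setReal 3 agentExpr (natVar 8)
      (.add (.mul (.sub (.const 1) fracExpr) (shareExpr (natVar 8)))
        (.mul fracExpr (shareExpr (.add (natVar 8) (.const 1))))))
    (.emit agentExpr (natVar 8)
      (.mul (.quantile agentExpr (.sub (.const 1) fracExpr))
        (.sub (.const 1) (shareExpr (natVar 8)))))

def rejectProgram : Program :=
  .seq (.setReal 3 agentExpr (natVar 8) (shareExpr (natVar 8))) (.emitTop agentExpr (natVar 8))

def cellProgram : Program :=
  .ite (.natLe (.add (natVar 8) (.const 1)) (.add (natVar 7) (.const 1)))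
    (.ite (.natLe (.const 1) stepsExpr) serveProgram rejectProgram) rejectProgram

def initShareProgram : Program :=
  forLoop 8 (.add (natVar 0) (.const 1)) (.setReal 3 (natVar 0) (natVar 8) (.weight (natVar 8)))

def outputProgram : Program :=
  forLoop 4 (natVar 0) (forLoop 8 (.add (natVar 0) (.const 1)) cellProgram)

/-- Column `j + 1` is read only when agent `i` can be served, that is for `j ≤ z`; with `z < n`,
columns up to `n` suffice. -/
lemma cellProgram_ensures {n : ℕ} {law : ℕ → MeasureTheory.Measure ℝ} {w : ℕ → ℝ≥0} {s : State}
    {i j z : ℕ} (hn : s.nat 0 0 0 = n) (hi : i < n) (h4 : s.nat 4 0 0 = n - (i + 1))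
    (h7 : s.nat 7 0 0 = z) (h8 : s.nat 8 0 0 = j)
    (hS : s.real 3 (i + 1) j = allocShare n w (s.nat 6 z) (z + 1) (n - (i + 1)) (i + 1) j)
    (hS' : j ≤ z → s.real 3 (i + 1) (j + 1) =
      allocShare n w (s.nat 6 z) (z + 1) (n - (i + 1)) (i + 1) (j + 1)) :
    Ensures (oracle law w) cellProgram s 400 (fun s' => s' =
      ⟨s.nat, update₃ s.real 3 i j (allocShare n w (s.nat 6 z) (z + 1) (n - i) i j),
        update₂ s.out i j (allocPrice n law w (s.nat 6 z) (z + 1) i j)⟩) := by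
  have hagent : agentExpr.eval s = i := by
    simp only [agentExpr, NatExpr.eval, natVar, hn, h4]; omega
  have hsteps : stepsExpr.eval s = s.nat 6 z i := by
    simp only [stepsExpr, NatExpr.eval, natVar, h7, hagent]
  have hfrac : fracExpr.eval (oracle law w) s = s.nat 6 z i / (4 * n) := by
    simp [fracExpr, RealExpr.eval, NatExpr.eval, natVar, hsteps, hn]
  have hshare : ∀ e : NatExpr, (shareExpr e).eval (oracle law w) s = s.real 3 (i + 1) (e.eval s) :=
    fun e => by simp only [shareExpr, RealExpr.eval, NatExpr.eval, hagent]
  have h8e : (natVar 8).eval s = j := by simp only [NatExpr.eval, natVar, h8]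
  have hm : n - i = n - (i + 1) + 1 := by omega
  have hreject : ¬ Served (s.nat 6 z) (z + 1) i j →
      Ensures (oracle law w) rejectProgram s 50 (fun s' => s' =
        ⟨s.nat, update₃ s.real 3 i j (allocShare n w (s.nat 6 z) (z + 1) (n - i) i j),
          update₂ s.out i j (allocPrice n law w (s.nat 6 z) (z + 1) i j)⟩) := fun hs => by
    refine (Ensures.seq (Ensures.setReal (Ensures.emitTop ?_))).mono ?_ fun _ h => h
    · rw [hm, allocShare, if_neg hs, allocPrice, if_neg hs, ← hS]
      simp only [hshare, h8e, hagent]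
      congr 2
    · simp [NatExpr.cost, RealExpr.cost, natVar, agentExpr, shareExpr]
  refine (Ensures.ite (T := 350) (T' := 50) (fun hju => (Ensures.ite (T := 250) (T' := 50)
    (fun hc => (Ensures.seq (Ensures.setReal (Ensures.emit ?_))).mono ?_ fun _ h => h)
    (fun hc => hreject ?_)).mono ?_ fun _ h => h) (fun hju => hreject ?_)).mono ?_ fun _ h => h
  · simp only [Test.Holds, NatExpr.eval, natVar, h8, h7, hsteps] at hju hc
    have hs : Served (s.nat 6 z) (z + 1) i j := ⟨hju, hc⟩
    rw [hm, allocShare, if_pos hs, allocPrice, if_pos hs, ← hS, ← hS' (by omega)]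
    simp only [RealExpr.eval, h8e, hagent, hfrac, NatExpr.eval, shareExpr]
    -- The price is evaluated after the share was stored. These expressions do not read real memory,
    -- and the store hits row `i` while the price reads row `i + 1`.
    have hq : ∀ r : ℕ → ℕ → ℕ → ℝ, fracExpr.eval (oracle law w) ⟨s.nat, r, s.out⟩ =
        s.nat 6 z i / (4 * n) := fun r => hfrac
    have ha : ∀ r : ℕ → ℕ → ℕ → ℝ, agentExpr.eval ⟨s.nat, r, s.out⟩ = i := fun r => hagent
    have h8' : ∀ r : ℕ → ℕ → ℕ → ℝ, (natVar 8).eval ⟨s.nat, r, s.out⟩ = j := fun r => h8e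
    simp only [hq, ha, h8']
    congr 2
    · simp
    · simp [oracle, update₃]
  · simp [NatExpr.cost, RealExpr.cost, natVar, agentExpr, shareExpr, fracExpr, stepsExpr]
  · simp only [Test.Holds, NatExpr.eval, hsteps] at hc
    exact fun hs => hc hs.2
  · simp [NatExpr.cost, Test.cost, natVar, agentExpr, stepsExpr]
  · simp only [Test.Holds, NatExpr.eval, natVar, h8, h7] at hju
    exact fun hs => hju hs.1
  · simp [NatExpr.cost, Test.cost, natVar]

lemma rowProgram_ensures {n : ℕ} {law : ℕ → MeasureTheory.Measure ℝ} {w : ℕ → ℝ≥0} {s : State}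
    {i z : ℕ} (hn : s.nat 0 0 0 = n) (hi : i < n) (h4 : s.nat 4 0 0 = n - (i + 1))
    (h7 : s.nat 7 0 0 = z) (hz : z < n)
    (hS : ∀ j ≤ n, s.real 3 (i + 1) j =
      allocShare n w (s.nat 6 z) (z + 1) (n - (i + 1)) (i + 1) j) :
    Ensures (oracle law w) (forLoop 8 (.add (natVar 0) (.const 1)) cellProgram) s
      ((n + 2) * 420) (fun s' => (∀ a, a ≠ 8 → s'.nat a = s.nat a) ∧
        (∀ i', i' ≠ i → s'.real 3 i' = s.real 3 i' ∧ s'.out i' = s.out i') ∧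
        ∀ j < n + 1, s'.real 3 i j = allocShare n w (s.nat 6 z) (z + 1) (n - i) i j ∧
          s'.out i j = allocPrice n law w (s.nat 6 z) (z + 1) i j) := by
  refine (Ensures.forLoop (m := n + 1) (T := 400) (fun k s' => (∀ a, a ≠ 8 → s'.nat a = s.nat a) ∧
        (∀ i', i' ≠ i → s'.real 3 i' = s.real 3 i' ∧ s'.out i' = s.out i') ∧
        ∀ j < k, s'.real 3 i j = allocShare n w (s.nat 6 z) (z + 1) (n - i) i j ∧
          s'.out i j = allocPrice n law w (s.nat 6 z) (z + 1) i j) ?_ ?_ ?_).mono ?_ fun _ h => h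
  · exact ⟨fun a ha => State.setVar_nat_of_ne _ ha 0, fun _ _ => ⟨rfl, rfl⟩, fun j hj =>
      absurd hj (Nat.not_lt_zero j)⟩
  · rintro k s' ⟨h, -⟩
    simp [NatExpr.eval, natVar, h, hn]
  · rintro k hk s₁ ⟨g1, g2, g3⟩ h8
    have h6 : s₁.nat 6 = s.nat 6 := g1 6 (by norm_num)
    have hnext := (g2 (i + 1) (by omega)).1
    refine (cellProgram_ensures (n := n) (w := w) (law := law) (by rw [g1 0 (by norm_num), hn]) hi
      (by rw [g1 4 (by norm_num), h4]) (by rw [g1 7 (by norm_num), h7]) h8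
      (by rw [hnext, h6]; exact hS k (by omega))
      (fun hkz => by rw [hnext, h6]; exact hS (k + 1) (by omega))).mono le_rfl ?_
    rintro s₂ rfl
    refine ⟨h8, fun a ha => ?_, fun i' hi' => ?_, fun j hj => ?_⟩
    · rw [State.setVar_nat_of_ne _ ha]; exact g1 a ha
    · simp only [State.setVar]
      rw [update₃_self, update₂_eq, Function.update_of_ne hi', Function.update_of_ne hi']
      exact g2 i' hi'
    · simp only [State.setVar]
      rw [update₃_self, update₂_eq, Function.update_self, Function.update_self, h6]
      rcases eq_or_ne j k with rfl | hne
      · rw [Function.update_self, Function.update_self]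
        exact ⟨rfl, rfl⟩
      · rw [Function.update_of_ne hne, Function.update_of_ne hne]
        exact g3 j (by omega)
  · simp only [NatExpr.cost, natVar]
    exact Nat.mul_le_mul_left _ (by omega)

lemma initShareProgram_ensures {n : ℕ} {law : ℕ → MeasureTheory.Measure ℝ} {w : ℕ → ℝ≥0}
    {s : State} (hn : s.nat 0 0 0 = n) :
    Ensures (oracle law w) initShareProgram s ((n + 2) * 40) (fun s' =>
      (∀ a, a ≠ 8 → s'.nat a = s.nat a) ∧ ∀ j < n + 1, s'.real 3 n j = w j) := by
  refine (Ensures.forLoop (m := n + 1) (T := 20) (fun k s' =>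
      (∀ a, a ≠ 8 → s'.nat a = s.nat a) ∧ ∀ j < k, s'.real 3 n j = w j) ?_ ?_ ?_).mono ?_ fun _ h => h
  · exact ⟨fun a ha => State.setVar_nat_of_ne _ ha 0, fun j hj => absurd hj (Nat.not_lt_zero j)⟩
  · rintro k s' ⟨h, -⟩
    simp [NatExpr.eval, natVar, h, hn]
  · rintro k - s₁ ⟨g1, g2⟩ h8
    have h0 : s₁.nat 0 0 0 = n := by rw [g1 0 (by norm_num), hn]
    refine (Ensures.setReal ?_).mono ?_ fun _ h => h
    · simp only [NatExpr.eval, natVar, h8, h0, RealExpr.eval, oracle]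
      refine ⟨trivial, fun a ha => ?_, fun j hj => ?_⟩
      · rw [State.setVar_nat_of_ne _ ha]; exact g1 a ha
      · simp only [State.setVar]
        rw [update₃_self, Function.update_self]
        rcases eq_or_ne j k with rfl | hne
        · rw [Function.update_self]
        · rw [Function.update_of_ne hne]
          exact g2 j (by omega)
    · simp [NatExpr.cost, RealExpr.cost, natVar]
  · simp only [NatExpr.cost, natVar]
    exact Nat.mul_le_mul_left _ (by omega)

/-- Agents are treated from last to first, so row `i + 1` of the share table is ready when agent `i`
is priced; row `n` holds `w`. -/
lemma outputProgram_ensures {n : ℕ} {law : ℕ → MeasureTheory.Measure ℝ} {w : ℕ → ℝ≥0} {s : State}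
    {z : ℕ} (hn : s.nat 0 0 0 = n) (h7 : s.nat 7 0 0 = z) (hz : z < n)
    (hS : ∀ j < n + 1, s.real 3 n j = w j) :
    Ensures (oracle law w) outputProgram s ((n + 1) * ((n + 2) * 420 + 20)) (fun s' =>
      ∀ i < n, ∀ j ≤ n, s'.out i j = allocPrice n law w (s.nat 6 z) (z + 1) i j) := by
  refine (Ensures.forLoop (m := n) (T := (n + 2) * 420) (fun k s' =>
      (∀ a, a ≠ 4 → a ≠ 8 → s'.nat a = s.nat a) ∧ ∀ i ≤ n, n ≤ i + k → ∀ j ≤ n,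
        s'.real 3 i j = allocShare n w (s.nat 6 z) (z + 1) (n - i) i j ∧
          (i < n → s'.out i j = allocPrice n law w (s.nat 6 z) (z + 1) i j)) ?_ ?_ ?_).mono ?_
      fun s' h i hi j hj => (h.2 i hi.le (by omega) j hj).2 hi
  · refine ⟨fun a ha _ => State.setVar_nat_of_ne _ ha 0, fun i hi hin j hj => ?_⟩
    obtain rfl : i = n := by omega
    refine ⟨?_, fun h => absurd h (lt_irrefl i)⟩
    rw [Nat.sub_self, allocShare]
    exact hS j (by omega)
  · rintro k s' ⟨h, -⟩
    simp [NatExpr.eval, natVar, h, hn]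
  · rintro k hk s₁ ⟨g1, g2⟩ h4
    obtain ⟨i, hi⟩ : ∃ i, i + 1 + k = n := ⟨n - (k + 1), by omega⟩
    have h6 : s₁.nat 6 = s.nat 6 := g1 6 (by norm_num) (by norm_num)
    refine (rowProgram_ensures (n := n) (w := w) (law := law) (i := i) (z := z)
      (by rw [g1 0 (by norm_num) (by norm_num), hn]) (by omega) (by omega)
      (by rw [g1 7 (by norm_num) (by norm_num), h7]) hz ?_).mono le_rfl ?_
    · rw [h6]
      exact fun j hj => (g2 (i + 1) (by omega) (by omega) j hj).1
    · rintro s₂ ⟨e1, e2, e3⟩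
      rw [h6] at e3
      refine ⟨by rw [e1 4 (by norm_num), h4], fun a a4 a8 => ?_, fun i' hi' hik j hj => ?_⟩
      · rw [State.setVar_nat_of_ne _ a4, e1 a a8, g1 a a4 a8]
      · simp only [State.setVar]
        rcases eq_or_ne i' i with rfl | hne
        · exact ⟨(e3 j (by omega)).1, fun _ => (e3 j (by omega)).2⟩
        · rw [(e2 i' hne).1, (e2 i' hne).2]
          exact g2 i' hi' (by omega) j hj
  · simp only [NatExpr.cost, natVar]
    exact Nat.mul_le_mul_left _ (by omega)

/-- Select a number of units and post the prices that implement its greedy allocation. -/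
def saleProgram : Program := .seq searchProgram (.seq initShareProgram outputProgram)

lemma saleProgram_ensures {n : ℕ} {law : ℕ → MeasureTheory.Measure ℝ} {w : ℕ → ℝ≥0}
    (hreg : ∀ i, i < n → IsRegular (law i)) (hn : 1 ≤ n) :
    Ensures (oracle law w) saleProgram (State.init n) (10000 * n ^ 4) (fun s =>
      ∃ s₁, SearchInv n law w n s₁ ∧ ∀ i < n, ∀ j ≤ n,
        s.out i j = allocPrice n law w (s₁.nat 6 (s₁.nat 7 0 0)) (s₁.nat 7 0 0 + 1) i j) := by
  refine (Ensures.seq (T' := (n + 2) * 40 + (n + 1) * ((n + 2) * 420 + 20))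
    ((searchProgram_ensures hreg hn).mono le_rfl fun s₁ h₁ =>
    Ensures.seq ((initShareProgram_ensures h₁.size).mono le_rfl fun s₂ h₂ => ?_))).mono ?_
    fun _ h => h
  · refine (outputProgram_ensures (n := n) (w := w) (law := law) (z := s₁.nat 7 0 0)
      (by rw [h₂.1 0 (by norm_num), h₁.size]) (by rw [h₂.1 7 (by norm_num)]) h₁.choice_lt
      h₂.2).mono le_rfl fun s₃ h₃ => ⟨s₁, h₁, ?_⟩
    rw [h₂.1 6 (by norm_num)] at h₃
    exact h₃
  · obtain ⟨m, rfl⟩ : ∃ m, n = m + 1 := ⟨n - 1, by omega⟩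
    ring_nf
    nlinarith [Nat.zero_le m, Nat.zero_le (m ^ 2), Nat.zero_le (m ^ 3), Nat.zero_le (m ^ 4)]

/-! ### The approximation guarantee -/

/-- A zero score claims nothing; a positive one forces a positive discount, which the price
construction needs for shares below `1`. -/
lemma SearchInv.le_revenue {n : ℕ} {law : ℕ → MeasureTheory.Measure ℝ} {w : ℕ → ℝ≥0}
    (hreg : ∀ i, i < n → IsRegular (law i)) (hw : IsAvailability n w) {s : State}
    (h : SearchInv n law w n s) {p : ℕ → ℕ → ℝ≥0∞}
    (hp : ∀ i < n, ∀ j ≤ n,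
      p i j = allocPrice n law w (s.nat 6 (s.nat 7 0 0)) (s.nat 7 0 0 + 1) i j) :
    ENNReal.ofReal (s.real 2 0 0 / 4) ≤ revenue n law w p := by
  rcases h.score_nonneg.eq_or_lt with h0 | hpos
  · simp [← h0]
  obtain ⟨-, heq⟩ := h.score_eq hpos
  have hg := (h.row _ h.choice_lt).1
  have hfeas : Feasible n (s.nat 6 (s.nat 7 0 0)) (s.nat 7 0 0 + 1) :=
    ⟨by omega, h.choice_lt, fun i hi => (hg.2.1 i hi).1, hg.1⟩
  have hd : 0 < discount w (s.nat 7 0 0 + 1) :=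
    pos_of_mul_pos_left (heq ▸ hpos) (allocRevenue_nonneg hreg _)
  rw [heq]
  exact le_revenue_of_eq_allocPrice hreg hw hfeas hd fun i j hj hi => hp i hi j (by omega)

lemma SearchInv.optRevenue_le {n : ℕ} {law : ℕ → MeasureTheory.Measure ℝ} {w : ℕ → ℝ≥0}
    (hreg : ∀ i, i < n → IsRegular (law i)) (hw : IsAvailability n w) {s : State} (hn : 1 ≤ n)
    (h : SearchInv n law w n s) :
    optRevenue n law w ≤ (Nat.log 2 n + 1 : ℕ) * ENNReal.ofReal (9 * s.real 2 0 0) := by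
  refine iSup_le fun p => (revenue_le_dyadic (fun i hi => (hreg i hi).1) hw p).trans ?_
  refine (Finset.sum_le_card_nsmul _ _ (ENNReal.ofReal (9 * s.real 2 0 0)) fun l hl => ?_).trans
    (by rw [Finset.card_range, nsmul_eq_mul])
  have hln : 2 ^ l ≤ n := Nat.pow_le_of_le_log (by omega)
    (Nat.le_of_lt_succ (Finset.mem_range.1 hl))
  have hpos : 1 ≤ 2 ^ l := Nat.one_le_two_pow
  have hsucc : 2 ^ (l + 1) = 2 * 2 ^ l := by ring
  -- Blocks `l = 0, 1` use `u = 1`, whose discount is `1`. Later ones use `u = 2 ^ l - 1`: then `2 ^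
  -- (l + 1) - 1 = 2 u + 1 ≤ 3 u`, and the discount `1 - w u` covers the block's increment of `w`.
  obtain ⟨y, hyn, hKy, hwy⟩ : ∃ y < n, min (2 ^ (l + 1) - 1) n ≤ 3 * (y + 1) ∧
      1 - (w (2 ^ l - 1) : ℝ) ≤ discount w (y + 1) := by
    rcases le_or_gt (2 ^ l) 2 with hle | hlt
    · refine ⟨0, by omega, by omega, ?_⟩
      simp [discount, hw.1]
    · refine ⟨2 ^ l - 2, by omega, by omega, ?_⟩
      rw [discount, show 2 ^ l - 2 + 1 - (2 - (2 ^ l - 2 + 1)) = 2 ^ l - 1 by omega]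
  have hopt := (h.row y hyn).1.optPrivate_le hreg (by omega) hKy
  have hV := allocRevenue_nonneg hreg (s.nat 6 y)
  have hinc : ((w (2 ^ (l + 1) - 1) - w (2 ^ l - 1) : ℝ≥0) : ℝ≥0∞) ≤
      ENNReal.ofReal (discount w (y + 1)) := by
    rw [← ENNReal.ofReal_coe_nnreal, NNReal.coe_sub (hw.2.1 (by omega))]
    refine ENNReal.ofReal_le_ofReal (le_trans ?_ hwy)
    have : (w (2 ^ (l + 1) - 1) : ℝ) ≤ 1 := by exact_mod_cast hw.le_one _
    linarith
  refine (mul_le_mul' hinc hopt).trans ?_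
  rw [← ENNReal.ofReal_mul' (by positivity)]
  refine ENNReal.ofReal_le_ofReal ?_
  have := h.score_le y hyn
  linarith

lemma log_two_add_one_le {n : ℕ} (hn : 1 ≤ n) :
    ((Nat.log 2 n + 1 : ℕ) : ℝ) ≤ 2 * (1 + Real.log n) := by
  have h1 := Real.natLog_le_logb n 2
  have h2 : (1 / 2 : ℝ) ≤ Real.log 2 := by linarith [Real.log_two_gt_d9]
  have h3 : 0 ≤ Real.log n := Real.log_nonneg (by exact_mod_cast hn)
  have h4 : Real.log n / Real.log 2 ≤ Real.log n / (1 / 2) :=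
    div_le_div_of_nonneg_left h3 (by norm_num) h2
  rw [Real.logb] at h1
  push_cast at h1 ⊢
  linarith

theorem optRevenue_le_log_mul_revenue {n : ℕ} {law : ℕ → MeasureTheory.Measure ℝ} {w : ℕ → ℝ≥0}
    (hreg : ∀ i, i < n → IsRegular (law i)) (hw : IsAvailability n w) {s : State} (hn : 1 ≤ n)
    (h : SearchInv n law w n s) {p : ℕ → ℕ → ℝ≥0∞}
    (hp : ∀ i < n, ∀ j ≤ n,
      p i j = allocPrice n law w (s.nat 6 (s.nat 7 0 0)) (s.nat 7 0 0 + 1) i j) :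
    optRevenue n law w ≤ ENNReal.ofReal (72 * (1 + Real.log n)) * revenue n law w p := by
  have hs := h.score_nonneg
  have hlog := log_two_add_one_le hn
  calc optRevenue n law w
      ≤ (Nat.log 2 n + 1 : ℕ) * ENNReal.ofReal (9 * s.real 2 0 0) := h.optRevenue_le hreg hw hn
    _ = ENNReal.ofReal (36 * (Nat.log 2 n + 1 : ℕ)) * ENNReal.ofReal (s.real 2 0 0 / 4) := by
        rw [← ENNReal.ofReal_natCast, ← ENNReal.ofReal_mul (by positivity),
          ← ENNReal.ofReal_mul (by positivity)]
        congr 1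
        ring
    _ ≤ _ := mul_le_mul' (ENNReal.ofReal_le_ofReal (by linarith)) (h.le_revenue hreg hw hp)

end AvailabilitySale

end

theorem mainTheorem8 :
    -- a polynomial-time algorithm with approximation factor `O(log n)`
    (∃ (A : AvailabilitySale.Program) (C : ℝ) (d : ℕ),
      ∀ (n : ℕ) (law : ℕ → MeasureTheory.Measure ℝ) (w : ℕ → NNReal), 1 ≤ n →
        (∀ i, i < n → AvailabilitySale.IsRegular (law i)) →
        AvailabilitySale.IsAvailability n w →
        ∃ (s : AvailabilitySale.State) (t : ℕ),
          AvailabilitySale.Exec (AvailabilitySale.oracle law w) A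
            (AvailabilitySale.State.init n) s t ∧
          t ≤ d * n ^ d ∧
          AvailabilitySale.optRevenue n law w ≤
            ENNReal.ofReal (C * (1 + Real.log n)) *
              AvailabilitySale.revenue n law w s.out) ∧
    -- the decomposition of the revenue of every price matrix, and its dyadic grouping
    (∀ (n : ℕ) (law : ℕ → MeasureTheory.Measure ℝ) (w : ℕ → NNReal), 1 ≤ n →
        (∀ i, i < n → AvailabilitySale.IsRegular (law i)) →
        AvailabilitySale.IsAvailability n w →
        ∀ p : ℕ → ℕ → ENNReal,
          AvailabilitySale.revenue n law w p =
            ∑ k ∈ Finset.Icc 1 n, ((w k - w (k - 1) : NNReal) : ENNReal) *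
              AvailabilitySale.component n law w p k ∧
          (∀ k ∈ Finset.Icc 1 n,
            AvailabilitySale.component n law w p k ≤ AvailabilitySale.optPrivate n law k) ∧
          AvailabilitySale.revenue n law w p ≤
            ∑ l ∈ Finset.range (Nat.log 2 n + 1),
              ((w (2 ^ (l + 1) - 1) - w (2 ^ l - 1) : NNReal) : ENNReal) *
                AvailabilitySale.optPrivate n law (min (2 ^ (l + 1) - 1) n)) := by
  -- The constant `72` is `4 * 9` times the factor `2` for passing to the natural logarithm. The
  -- single `d` is both coefficient and exponent, so the bound `10000 * n ^ 4` is weakened to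
  -- exponent `10000`.
  refine ⟨⟨AvailabilitySale.saleProgram, 72, 10000, fun n law w hn hreg hw => ?_⟩,
    fun n law w _ hreg hw p => ?_⟩
  · obtain ⟨s, t, hexec, ht, s₁, hinv, hp⟩ :=
      AvailabilitySale.saleProgram_ensures (w := w) hreg hn
    refine ⟨s, t, hexec, ht.trans ?_,
      AvailabilitySale.optRevenue_le_log_mul_revenue hreg hw hn hinv hp⟩
    have hpow : ∀ d, 4 ≤ d → 10000 * n ^ 4 ≤ 10000 * n ^ d := fun d hd =>
      Nat.mul_le_mul_left _ (Nat.pow_le_pow_right hn hd)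
    exact hpow _ (by norm_num)
  · have hlaw : ∀ i, i < n → MeasureTheory.IsProbabilityMeasure (law i) := fun i hi => (hreg i hi).1
    exact ⟨AvailabilitySale.revenue_eq_sum_component hlaw hw p,
      fun k hk => AvailabilitySale.component_le_optPrivate hlaw w p (Finset.mem_Icc.1 hk).2,
      AvailabilitySale.revenue_le_dyadic hlaw hw p⟩
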